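/- Let $0\le T<\infty$ and let $(\Omega,\mathcal F,\mathbb P)$ be a complete probability space carrying an $(m+n)$-dimensional standard Brownian motion $\overline W=(W,W^\perp)$ on $[0,T]$, with augmented filtration $(\mathcal F_t)_{0\le t\le T}$. Let $S_t=S_0+\int_0^t\lambda_s\,ds+W_t$, where $S_0\in\mathbf R^m$ and $\lambda$ is a uniformly bounded $\mathbf R^m$-valued process, predictable with respect to the filtration generated by $W$. Let $\mathcal M$ be the set of probability measures $\mathbb Q$ equivalent to $\mathbb P$ under which $S$ is a local martingale on $[0,T]$, and let $\mathbb Q^{min}$ be the minimal martingale measure, $\frac{d\mathbb Q^{min}}{d\mathbb P}=\exp\left(-\int_0^T\lambda_s\cdot dW_s-\frac12\int_0^T|\lambda_s|^2ds\right)$. Let $\gamma>0$, $q>0$, $q\neq1$. Put $\ln_q x=\frac{x^{1-q}-1}{1-q}$, with domain $[0,\infty)$ if $0<q<1$ and $(0,\infty)$ if $q>1$, and $\exp_q(x)=[1+(1-q)x]^{1/(1-q)}$, with domain $\{x\ge-\frac1{1-q}\}$ if $0<q<1$ and $\{x<-\frac1{1-q}\}$ if $q>1$. For $\mathbb Q\in\mathcal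 M$ let $D_t=D_t^{\mathbb Q,\mathbb Q^{min}}=\mathbb E_{\mathbb Q^{min}}\left[\frac{d\mathbb Q}{d\mathbb Q^{min}}\,\middle|\,\mathcal F_t\right]$ and $D_{t,T}=D_T/D_t$, let $$H_q(\mathbb Q|\mathbb Q^{min})=\mathbb E_{\mathbb Q^{min}}[D_T^q\ln_qD_T],\qquad H_{q,t}(\mathbb Q|\mathbb Q^{min})=\mathbb E_{\mathbb Q^{min}}[D_{t,T}^q\ln_qD_{t,T}\,|\,\mathcal F_t],$$ and let $\mathcal M_f=\{\mathbb Q\in\mathcal M: H_q(\mathbb Q|\mathbb Q^{min})<+\infty\}$. Conditional expectations of random variables that need not be integrable are understood as $\mathbb E[X^+|\mathcal F_t]-\mathbb E[X^-|\mathcal F_t]$. Let $\mathcal L_q^\gamma(\mathcal F_T,b)$ be the set of $\mathcal F_T$-measurable real random variables $\xi$ such that $-\gamma\xi$ is a.s. in the domain of $\exp_q$, $\exp_q(-\gamma\xi)\in L^1(\mathbb P)$, $\mathbb E_{\mathbb P}[\exp_q(-\gamma\xi)]$ is in the domain of $\ln_q$, and $0<m_1\le\exp_q(-\gamma\xi)\le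 m_2$ a.s. for some constants $m_1,m_2$. For $t\in[0,T]$ and $\xi\in\mathcal L_q^\gamma(\mathcal F_T,b)$ the pricing principle is $$F_t(\xi)=\operatorname*{ess\,inf}_{\mathbb Q\in\mathcal M_f}\left(\mathbb E_{\mathbb Q^{min}}\left[D_{t,T}^q\,\xi\,|\,\mathcal F_t\right]+\frac1\gamma H_{q,t}(\mathbb Q|\mathbb Q^{min})\right).$$ **Proposition.** Let $t\in[0,T]$, let $c\in\mathbf R$ be a constant, and suppose $\xi,\ \xi+c\in\mathcal L_q^\gamma(\mathcal F_T,b)$. Then: (i) (Cash superadditivity) if $0<q<1$ and $c\le0$, or $q>1$ and $c\ge0$, then $F_t(\xi+c)\ge F_t(\xi)+c$ $\mathbb P$-a.s.; (ii) (Cash subadditivity) if $0<q<1$ and $c\ge0$, or $q>1$ and $c\le0$, then $F_t(\xi+c)\le F_t(\xi)+c$ $\mathbb P$-a.s. -/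

import Mathlib

open MeasureTheory ProbabilityTheory Filter Topology

namespace TsallisPricing

noncomputable section

/-! ### The `q`-exponential and the `q`-logarithm -/

/-- The domain of the `q`-exponential. -/
def expqDomain (q : ℝ) : Set ℝ :=
  {x | (0 < q ∧ q < 1 ∧ -(1 / (1 - q)) ≤ x) ∨ (1 < q ∧ x < -(1 / (1 - q)))}

/-- The `q`-exponential (meaningful on `expqDomain q`). -/
def expq (q x : ℝ) : ℝ := (1 + (1 - q) * x) ^ (1 / (1 - q))

/-- The domain of the `q`-logarithm. -/
def lnqDomain (q : ℝ) : Set ℝ :=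
  {x | (0 < q ∧ q < 1 ∧ 0 ≤ x) ∨ (1 < q ∧ 0 < x)}

/-- The `q`-logarithm (meaningful on `lnqDomain q`). -/
def lnq (q x : ℝ) : ℝ := (x ^ (1 - q) - 1) / (1 - q)

/-! ### Essential infimum of a family, extended conditional expectation -/

section General

variable {Ω : Type*} (m : MeasurableSpace Ω) [mΩ : MeasurableSpace Ω]

/-- `Y` is an essential infimum of the family `𝒳` of extended-real random variables, among the
`m`-measurable ones: the `P`-a.s. greatest `m`-measurable a.s. lower bound of `𝒳`. -/
structure IsEssInf (P : Measure Ω) (𝒳 : Set (Ω → EReal))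
    (Y : Ω → EReal) : Prop where
  measurable : Measurable[m] Y
  le : ∀ X ∈ 𝒳, Y ≤ᵐ[P] X
  greatest : ∀ Z : Ω → EReal, Measurable[m] Z → (∀ X ∈ 𝒳, Z ≤ᵐ[P] X) → Z ≤ᵐ[P] Y

/-- Essential infima always exist. -/
theorem exists_isEssInf (hm : m ≤ mΩ) (P : Measure Ω) [IsFiniteMeasure P]
    (𝒳 : Set (Ω → EReal)) : ∃ Y, IsEssInf m P 𝒳 Y := by
  classical
  let φ : EReal → ENNReal := fun x => (1 + EReal.exp (-x))⁻¹
  have hφ : StrictMono φ := by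
    intro x y hxy
    refine ENNReal.inv_lt_inv.2 (ENNReal.add_lt_add_left (by simp) ?_)
    exact EReal.exp_strictMono (EReal.neg_lt_neg_iff.2 hxy)
  have hφm : Measurable φ := hφ.monotone.measurable
  have hφ1 : ∀ x, φ x ≤ 1 := fun x => ENNReal.inv_le_one.2 le_self_add
  let L : Set (Ω → EReal) := {Z | Measurable[m] Z ∧ ∀ X ∈ 𝒳, Z ≤ᵐ[P] X}
  have hL : (⊥ : Ω → EReal) ∈ L :=
    ⟨measurable_const, fun X _ => Eventually.of_forall fun ω => bot_le⟩
  let A : Set ENNReal := (fun Z : Ω → EReal => ∫⁻ ω, φ (Z ω) ∂P) '' L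
  obtain ⟨u, -, hu, huA⟩ := exists_seq_tendsto_sSup (S := A) (Set.Nonempty.image _ ⟨_, hL⟩) (OrderTop.bddAbove A)
  choose Z hZL hZu using huA
  let Y : Ω → EReal := fun ω => ⨆ k, Z k ω
  have hYm : Measurable[m] Y := Measurable.iSup fun k => (hZL k).1
  have hYle : ∀ X ∈ 𝒳, Y ≤ᵐ[P] X := by
    intro X hX
    filter_upwards [ae_all_iff.2 fun k => (hZL k).2 X hX] with ω hω using iSup_le hω
  have hsup : sSup A ≤ ∫⁻ ω, φ (Y ω) ∂P := by
    refine le_of_tendsto' hu fun k => ?_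
    rw [← hZu k]
    exact lintegral_mono fun ω => hφ.monotone (le_iSup (fun k => Z k ω) k)
  refine ⟨Y, hYm, hYle, fun V hV hVX => ?_⟩
  have hW : (fun ω => max (Y ω) (V ω)) ∈ L := by
    refine ⟨hYm.max hV, fun X hX => ?_⟩
    filter_upwards [hYle X hX, hVX X hX] with ω h1 h2 using max_le h1 h2
  have hint : ∫⁻ ω, φ (max (Y ω) (V ω)) ∂P ≤ ∫⁻ ω, φ (Y ω) ∂P :=
    (le_sSup (Set.mem_image_of_mem _ hW)).trans hsup
  have hfin : ∫⁻ ω, φ (Y ω) ∂P ≠ ⊤ := by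
    refine ne_top_of_le_ne_top (measure_ne_top P Set.univ) ?_
    calc ∫⁻ ω, φ (Y ω) ∂P ≤ ∫⁻ _, 1 ∂P := lintegral_mono fun ω => hφ1 _
      _ = P Set.univ := by simp
  have hae := ae_eq_of_ae_le_of_lintegral_le (μ := P) (f := fun ω => φ (Y ω))
    (g := fun ω => φ (max (Y ω) (V ω)))
    (Eventually.of_forall fun ω => hφ.monotone (le_max_left _ _)) hfin
    (Measurable.aemeasurable (hφm.comp ((hYm.max hV).mono hm le_rfl) :)) hint
  filter_upwards [hae] with ω hω
  have := hφ.injective hω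
  exact this ▸ le_max_right _ _

/-- The essential infimum of a family of extended-real random variables (unique up to a.s.
equality). -/
def essInfFamily (hm : m ≤ mΩ) (P : Measure Ω) [IsFiniteMeasure P]
    (𝒳 : Set (Ω → EReal)) : Ω → EReal :=
  (exists_isEssInf m hm P 𝒳).choose

theorem essInfFamily_spec (hm : m ≤ mΩ) (P : Measure Ω)
    [IsFiniteMeasure P] (𝒳 : Set (Ω → EReal)) : IsEssInf m P 𝒳 (essInfFamily m hm P 𝒳) :=
  (exists_isEssInf m hm P 𝒳).choose_spec

/-- Conditional expectation `E_R[X | m] = E_R[X⁺ | m] - E_R[X⁻ | m]`, for `X` not necessarily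
integrable. The variable `(D_{t,T})^q` has a finite conditional expectation
but need not be integrable, so that Mathlib's `condExp` (which is `0` there) would be wrong. -/
def condExpE (R : Measure Ω) (X : Ω → ℝ) (ω : Ω) : EReal :=
  ((condLExp m R (fun ω' => ENNReal.ofReal (X ω')) ω : ENNReal) : EReal)
    - ((condLExp m R (fun ω' => ENNReal.ofReal (-X ω')) ω : ENNReal) : EReal)

/-- Expectation `E_R[X] = E_R[X⁺] - E_R[X⁻]` with values in the extended reals. -/
def expectationE (R : Measure Ω) (X : Ω → ℝ) : EReal :=
  ((lintegral R fun ω => ENNReal.ofReal (X ω) : ENNReal) : EReal)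
    - ((lintegral R fun ω => ENNReal.ofReal (-X ω) : ENNReal) : EReal)

end General

/-! ### Brownian motion on `[0, T]`, its augmented filtration, the Itô integral -/

section Brownian

variable {Ω : Type*} [mΩ : MeasurableSpace Ω] {T : ℝ} [Fact (0 ≤ T)] {κ : Type*} [Fintype κ]

/-- `B` is a standard Brownian motion on `[0, T]` with coordinates indexed by `κ`. -/
structure IsStandardBrownian (B : Set.Icc (0 : ℝ) T → Ω → κ → ℝ) (P : Measure Ω) : Prop where
  measurable : ∀ t, Measurable (B t)
  zero : ∀ᵐ ω ∂P, B ⊥ ω = 0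
  indep_increments : HasIndepIncrements B P
  law_increments : ∀ s t : Set.Icc (0 : ℝ) T, s ≤ t →
    HasLaw (B t - B s) (Measure.pi fun _ : κ => gaussianReal 0 (Real.toNNReal (t - s))) P
  continuous_paths : ∀ᵐ ω ∂P, Continuous fun t => B t ω

/-- The filtration generated by `B`, without augmentation: `σ(B_s, s ≤ t)`. -/
def rawFiltration (B : Set.Icc (0 : ℝ) T → Ω → κ → ℝ) (hB : ∀ t, Measurable (B t)) :
    Filtration (Set.Icc (0 : ℝ) T) mΩ where
  seq t := ⨆ s ≤ t, MeasurableSpace.comap (B s) inferInstance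
  mono' _ _ hst := biSup_mono fun _ h => h.trans hst
  le' _ := iSup₂_le fun s _ => (hB s).comap_le

/-- The augmented filtration generated by `B`: `σ(B_s, s ≤ t)` together with all `P`-null sets. -/
def augmentedFiltration (B : Set.Icc (0 : ℝ) T → Ω → κ → ℝ) (hB : ∀ t, Measurable (B t))
    (P : Measure Ω) [P.IsComplete] : Filtration (Set.Icc (0 : ℝ) T) mΩ where
  seq t := rawFiltration B hB t ⊔ MeasurableSpace.generateFrom {N | P N = 0}
  mono' _ _ hst := sup_le_sup_right ((rawFiltration B hB).mono hst) _
  le' t := sup_le ((rawFiltration B hB).le t)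
    (MeasurableSpace.generateFrom_le fun s hs => Measure.IsComplete.out' s hs)

/-- Lebesgue measure on the time interval `[0, T]`. -/
def timeMeasure (T : ℝ) : Measure (Set.Icc (0 : ℝ) T) :=
  Measure.comap Subtype.val (volume : Measure ℝ)

/-- A simple integrand `∑ₖ ξₖ 1_{(tₖ, tₖ₊₁]}` with `ξₖ` bounded and `𝓕_{tₖ}`-measurable. -/
structure SimpleIntegrand (𝓕 : Filtration (Set.Icc (0 : ℝ) T) mΩ) (κ : Type*) where
  N : ℕ
  time : Fin (N + 1) → Set.Icc (0 : ℝ) T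
  monotone_time : Monotone time
  coeff : Fin N → Ω → κ → ℝ
  measurable_coeff : ∀ k, Measurable[𝓕 (time k.castSucc)] (coeff k)
  bounded_coeff : ∃ C : ℝ, ∀ k ω i, |coeff k ω i| ≤ C

namespace SimpleIntegrand

variable {𝓕 : Filtration (Set.Icc (0 : ℝ) T) mΩ}

/-- The process `∑ₖ ξₖ 1_{(tₖ, tₖ₊₁]}`. -/
def process (φ : SimpleIntegrand 𝓕 κ) (s : Set.Icc (0 : ℝ) T) (ω : Ω) (i : κ) : ℝ :=
  ∑ k, (Set.Ioc (φ.time k.castSucc) (φ.time k.succ)).indicator (fun _ => φ.coeff k ω i) s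

/-- Its stochastic integral `∑ₖ ξₖ · (B_{tₖ₊₁} - B_{tₖ})` over `[0, T]`. -/
def integral (φ : SimpleIntegrand 𝓕 κ) (B : Set.Icc (0 : ℝ) T → Ω → κ → ℝ) (ω : Ω) : ℝ :=
  ∑ k, ∑ i, φ.coeff k ω i * (B (φ.time k.succ) ω i - B (φ.time k.castSucc) ω i)

end SimpleIntegrand

/-- `I` is (a version of) the Itô integral `∫_0^T H_s · dB_s` of the square-integrable integrand
`H`: the `L²(P)`-limit of the integrals of simple integrands which converge to `H` in
`L²(P ⊗ ds)`. -/
def IsItoIntegral (𝓕 : Filtration (Set.Icc (0 : ℝ) T) mΩ) (P : Measure Ω)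
    (B : Set.Icc (0 : ℝ) T → Ω → κ → ℝ) (H : Set.Icc (0 : ℝ) T → Ω → κ → ℝ) (I : Ω → ℝ) : Prop :=
  Measurable[𝓕 ⊤] I ∧ ∃ φ : ℕ → SimpleIntegrand 𝓕 κ,
    Tendsto (fun j => ∫⁻ ω, ∫⁻ s,
      ENNReal.ofReal (∑ i, ((φ j).process s ω i - H s ω i) ^ 2) ∂(timeMeasure T) ∂P)
      atTop (𝓝 0) ∧
    Tendsto (fun j => ∫⁻ ω, ENNReal.ofReal (((φ j).integral B ω - I ω) ^ 2) ∂P) atTop (𝓝 0)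

end Brownian

/-! ### The market -/

/-- The market: an `(m+n)`-dimensional Brownian motion `(W, W^⊥)` on `[0, T]`, an initial price
`S_0`, and a bounded `ℝ^m`-valued process `λ`, predictable for the filtration generated by `W`. -/
structure Market (Ω : Type*) [mΩ : MeasurableSpace Ω] (P : Measure Ω) (T : ℝ) [Fact (0 ≤ T)]
    (m n : ℕ) where
  /-- the whole Brownian motion `(W, W^⊥)` -/
  Wbar : Set.Icc (0 : ℝ) T → Ω → (Fin m ⊕ Fin n) → ℝ
  isBrownian : IsStandardBrownian Wbar P
  /-- the initial prices -/
  S0 : Fin m → ℝ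
  /-- the drift `λ` -/
  lam : Set.Icc (0 : ℝ) T → Ω → Fin m → ℝ
  predictable_lam : IsStronglyPredictable
    (rawFiltration (fun t ω (i : Fin m) => Wbar t ω (Sum.inl i))
      (fun t => measurable_pi_lambda _ fun i =>
        (measurable_pi_apply (Sum.inl i)).comp (isBrownian.measurable t))) lam
  bounded_lam : ∃ C : ℝ, ∀ t ω i, |lam t ω i| ≤ C

namespace Market

variable {Ω : Type*} [mΩ : MeasurableSpace Ω] {P : Measure Ω} {T : ℝ} [Fact (0 ≤ T)] {m n : ℕ}

/-- The first `m` components `W` of the Brownian motion. -/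
def W (M : Market Ω P T m n) (t : Set.Icc (0 : ℝ) T) (ω : Ω) (i : Fin m) : ℝ :=
  M.Wbar t ω (Sum.inl i)

/-- The augmented filtration `(𝓕_t)` of `(W, W^⊥)`. -/
def 𝓕 (M : Market Ω P T m n) [P.IsComplete] : Filtration (Set.Icc (0 : ℝ) T) mΩ :=
  augmentedFiltration M.Wbar M.isBrownian.measurable P

/-- The price process `S_t = S_0 + ∫_0^t λ_s ds + W_t`. -/
def S (M : Market Ω P T m n) (t : Set.Icc (0 : ℝ) T) (ω : Ω) (i : Fin m) : ℝ :=
  M.S0 i + (∫ s in Set.Iic t, M.lam s ω i ∂(timeMeasure T)) + M.W t ω i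

/-- The set `𝓜` of probability measures equivalent to `P` under which `S` is a
local martingale. -/
def martingaleMeasures (M : Market Ω P T m n) [P.IsComplete] : Set (Measure Ω) :=
  {Q | IsProbabilityMeasure Q ∧ Q ≪ P ∧ P ≪ Q ∧
    Locally (fun X => Martingale X M.𝓕 Q) M.𝓕 M.S Q}

/-- `Qmin` is the minimal martingale measure:
`dQmin/dP = 𝓔(-λ·W)_T = exp (-∫_0^T λ_s · dW_s - ½ ∫_0^T |λ_s|² ds)`. -/
def IsMinimalMartingaleMeasure (M : Market Ω P T m n) [P.IsComplete] (Qmin : Measure Ω) : Prop :=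
  ∃ I : Ω → ℝ, IsItoIntegral M.𝓕 P M.W M.lam I ∧
    Qmin = P.withDensity fun ω => ENNReal.ofReal
      (Real.exp (-I ω - (1 / 2) * ∫ s, ∑ i, M.lam s ω i ^ 2 ∂(timeMeasure T)))

/-- The density process `D_t^{Q,R} = E_R[dQ/dR | 𝓕_t]`. -/
def density (M : Market Ω P T m n) [P.IsComplete] (Q R : Measure Ω)
    (t : Set.Icc (0 : ℝ) T) : Ω → ℝ :=
  condExp (M.𝓕 t) R fun ω => (Q.rnDeriv R ω).toReal

/-- `D_{t,T}^{Q,R} = D_T^{Q,R} / D_t^{Q,R}`. -/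
def densityRatio (M : Market Ω P T m n) [P.IsComplete] (Q R : Measure Ω)
    (t : Set.Icc (0 : ℝ) T) (ω : Ω) : ℝ :=
  M.density Q R ⊤ ω / M.density Q R t ω

open Classical in
/-- The Tsallis relative entropy `H_q(Q|R) = E_R[(D_T)^q ln_q D_T]` on `𝓕_T`, and `+∞` if `Q` is
not absolutely continuous with respect to `R`. -/
def entropy (M : Market Ω P T m n) [P.IsComplete] (q : ℝ) (Q R : Measure Ω) : EReal :=
  if Q ≪ R then
    expectationE R fun ω => M.density Q R ⊤ ω ^ q * lnq q (M.density Q R ⊤ ω)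
  else ⊤

/-- The conditional Tsallis relative entropy
`H_{q,t}(Q|R) = E_R[(D_{t,T})^q ln_q D_{t,T} | 𝓕_t]`. -/
def condEntropy (M : Market Ω P T m n) [P.IsComplete] (q : ℝ) (Q R : Measure Ω)
    (t : Set.Icc (0 : ℝ) T) : Ω → EReal :=
  condExpE (M.𝓕 t) R fun ω => M.densityRatio Q R t ω ^ q * lnq q (M.densityRatio Q R t ω)

/-- `𝓜_f`: the measures of `𝓜` with finite Tsallis relative entropy with respect to `Qmin`. -/
def finiteEntropyMeasures (M : Market Ω P T m n) [P.IsComplete] (q : ℝ) (Qmin : Measure Ω) :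
    Set (Measure Ω) :=
  {Q | Q ∈ M.martingaleMeasures ∧ M.entropy q Q Qmin < ⊤}

/-- The class `𝓛_q^γ(𝓕_t)`. -/
def claims (M : Market Ω P T m n) [P.IsComplete] (q γ : ℝ) (t : Set.Icc (0 : ℝ) T) :
    Set (Ω → ℝ) :=
  {ξ | Measurable[M.𝓕 t] ξ ∧ (∀ᵐ ω ∂P, -γ * ξ ω ∈ expqDomain q) ∧
    Integrable (fun ω => expq q (-γ * ξ ω)) P ∧
    ∫ ω, expq q (-γ * ξ ω) ∂P ∈ lnqDomain q}

/-- The class `𝓛_q^γ(𝓕_t, b)`. -/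
def boundedClaims (M : Market Ω P T m n) [P.IsComplete] (q γ : ℝ) (t : Set.Icc (0 : ℝ) T) :
    Set (Ω → ℝ) :=
  {ξ | ξ ∈ M.claims q γ t ∧ ∃ m₁ m₂ : ℝ, 0 < m₁ ∧
    ∀ᵐ ω ∂P, m₁ ≤ expq q (-γ * ξ ω) ∧ expq q (-γ * ξ ω) ≤ m₂}

/-- The value of `ξ` at time `t` under the model `Q`:
`E_{Qmin}[(D_{t,T})^q ξ | 𝓕_t] + (1/γ) H_{q,t}(Q|Qmin)`. -/
def evaluation (M : Market Ω P T m n) [P.IsComplete] (q γ : ℝ) (Qmin : Measure Ω)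
    (t : Set.Icc (0 : ℝ) T) (ξ : Ω → ℝ) (Q : Measure Ω) (ω : Ω) : EReal :=
  condExpE (M.𝓕 t) Qmin (fun ω' => M.densityRatio Q Qmin t ω' ^ q * ξ ω') ω
    + ((1 / γ : ℝ) : EReal) * M.condEntropy q Q Qmin t ω

/-- The pricing principle `F_t(ξ)`: the essential infimum of the evaluations over `𝓜_f`. -/
def pricing (M : Market Ω P T m n) [P.IsComplete] [IsFiniteMeasure P] (q γ : ℝ)
    (Qmin : Measure Ω) (t : Set.Icc (0 : ℝ) T) (ξ : Ω → ℝ) : Ω → EReal :=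
  essInfFamily (M.𝓕 t) (M.𝓕.le t) P
    {X | ∃ Q ∈ M.finiteEntropyMeasures q Qmin, X = M.evaluation q γ Qmin t ξ Q}

end Market

end

end TsallisPricing

/-! Fix `Q` in `𝓜_f` and write Y for the conditional expectation of `D_{t,T}^q` under `Qmin` given
`𝓕_t`. Adding the constant `c` to the claim leaves the entropy term alone and adds `c` Y to the
evaluation (`exists_evaluation_add_const`). Since `D_{t,T}` is positive with conditional expectation
one, Jensen's inequality gives Y ≤ 1 for `q < 1` and Y ≥ 1 for `q > 1`. The sign of `c` (Y - 1) is
therefore known in each case. The resulting inequality between evaluations holds for every `Q`, so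
it passes to the essential infimum (`pricing_add_const_le`).

The rest justifies this algebra. Splitting off `c` Y requires `ξ` bounded, which the bounds on
`expq` provide, and Y finite. For `q < 1` finiteness comes with the Jensen bound; for `q > 1` it
comes from finite entropy (`condLExp_densityRatio_rpow_ne_top`).

Conditional expectations under `Qmin` also require `Qmin` to be finite and equivalent to `P`. For
finiteness, the stochastic exponential of a simple integrand has expectation one, by independence of
Brownian increments and the Gaussian Laplace transform. Fatou's lemma along simple integrands
converging to `λ` then gives `lintegral_exp_neg_lt_top`. -/

namespace TsallisPricing

/-! ### Independence of a Brownian increment from the augmented past. -/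

section Independence

variable {Ω : Type*} [mΩ : MeasurableSpace Ω]

/-- A finite set of times below `s` can be enumerated by a monotone sequence from `⊥` to `s` which
then jumps to `t`. -/
theorem exists_monotone_enumeration {ι : Type*} [LinearOrder ι] [OrderBot ι] {s t : ι}
    (hst : s ≤ t) (I : Finset ι) (hI : ∀ r ∈ I, r ≤ s) :
    ∃ (τ : ℕ → ι) (k : ℕ), Monotone τ ∧ τ 0 = ⊥ ∧ τ k = s ∧ τ (k + 1) = t ∧
      ∀ r ∈ I, ∃ j ≤ k, τ j = r := by
  classical
  let J : Finset ι := insert ⊥ (insert s I)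
  have hJ0 : J.Nonempty := ⟨⊥, by simp [J]⟩
  have hJs : ∀ r ∈ J, r ≤ s := by
    intro r hr
    simp only [J, Finset.mem_insert] at hr
    rcases hr with rfl | rfl | hr
    · exact bot_le
    · exact le_rfl
    · exact hI r hr
  obtain ⟨k, hk⟩ : ∃ k, J.card = k + 1 := Nat.exists_eq_succ_of_ne_zero hJ0.card_pos.ne'
  let e := J.orderEmbOfFin hk
  have he : ∀ i, e i ≤ s := fun i => hJs _ (Finset.orderEmbOfFin_mem J hk i)
  have hsurj : ∀ r ∈ J, ∃ i, e i = r := by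
    intro r hr
    have : r ∈ Set.range (J.orderEmbOfFin hk) := by rw [Finset.range_orderEmbOfFin]; exact hr
    exact this
  refine ⟨fun j => if h : j < k + 1 then e ⟨j, h⟩ else t, k, ?_, ?_, ?_, ?_, ?_⟩
  · intro a b hab
    by_cases hb : b < k + 1
    · have ha : a < k + 1 := by omega
      simp only [ha, hb, dif_pos]
      exact e.monotone (by simpa using hab)
    · by_cases ha : a < k + 1
      · simp only [ha, hb, dif_pos, dif_neg, not_false_iff]
        exact (he _).trans hst
      · simp [ha, hb]
  · simp only [Nat.succ_pos, dif_pos]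
    obtain ⟨i, hi⟩ := hsurj ⊥ (by simp [J])
    exact le_bot_iff.1 (hi ▸ e.monotone (Fin.zero_le i))
  · simp only [Nat.lt_succ_self, dif_pos]
    obtain ⟨i, hi⟩ := hsurj s (by simp [J])
    exact le_antisymm (he _) (hi ▸ e.monotone (Fin.le_last i))
  · simp
  · intro r hr
    obtain ⟨i, hi⟩ := hsurj r (by simp [J, hr])
    exact ⟨i, by omega, by simp [Nat.le_of_lt_succ i.2, hi]⟩

variable {P : Measure Ω} [IsProbabilityMeasure P]

/-- An increment of a process with independent increments, started at `0`, is independent of the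
path up to the beginning of the increment. -/
theorem HasIndepIncrements.indepFun_path {ι : Type*} [LinearOrder ι] [OrderBot ι] {κ : Type*}
    {B : ι → Ω → κ → ℝ} (hB : ∀ t, Measurable (B t)) (hinc : HasIndepIncrements B P)
    (h0 : ∀ᵐ ω ∂P, B ⊥ ω = 0) {s t : ι} (hst : s ≤ t) :
    IndepFun (fun ω (r : Set.Iic s) => B r ω) (fun ω => B t ω - B s ω) P := by
  have key : IndepFun (fun ω (r : Set.Iic s) => B r ω - B ⊥ ω) (fun ω => B t ω - B s ω) P := by
    -- It suffices to treat finitely many times. Enumerated increasingly, they make the past a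
    -- function of the first `k` increments, while the new increment has index `k`.
    refine IndepFun.process_indepFun (X := fun (r : Set.Iic s) ω => B r ω - B ⊥ ω)
      (fun r => (hB _).sub (hB _)) ((hB _).sub (hB _)) fun I => ?_
    classical
    obtain ⟨τ, k, hτ, hτ0, hτk, hτk1, hτI⟩ := exists_monotone_enumeration hst
      (I.image Subtype.val) (by simp +contextual)
    let X : ℕ → Ω → κ → ℝ := fun i ω => B (τ (i + 1)) ω - B (τ i) ω
    have hX : ∀ i, Measurable (X i) := fun i => (hB _).sub (hB _)
    have hind : iIndepFun X P := hinc.nat hτ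
    have hdis := indep_iSup_of_disjoint (m := fun i => MeasurableSpace.comap (X i) inferInstance)
      (fun i => (hX i).comap_le) hind (S := {i | i < k}) (T := {k})
      (by simp)
    have hY : MeasurableSpace.comap (fun ω => B t ω - B s ω) inferInstance
        = MeasurableSpace.comap (X k) inferInstance := by simp only [X, hτk, hτk1]
    change Indep _ _ P
    rw [hY]
    refine indep_of_indep_of_le_left (indep_of_indep_of_le_right hdis ?_) ?_
    · exact le_iSup₂_of_le k rfl le_rfl
    · rw [← measurable_iff_comap_le]
      refine @measurable_pi_lambda _ _ _ (_) _ _ fun r => ?_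
      obtain ⟨j, hj, hjr⟩ := hτI r.1.1 (Finset.mem_image.2 ⟨r.1, r.2, rfl⟩)
      have hsum : (fun ω => B r.1.1 ω - B ⊥ ω) = fun ω => ∑ i ∈ Finset.range j, X i ω := by
        funext ω
        rw [Finset.sum_range_sub (fun i => B (τ i) ω), hjr, hτ0]
      rw [hsum]
      refine @Finset.measurable_fun_sum _ _ _ _ _ _ (_) _ _ fun i hi => ?_
      rw [measurable_iff_comap_le]
      exact le_iSup₂_of_le (f := fun i (_ : i ∈ {i | i < k}) =>
        MeasurableSpace.comap (X i) inferInstance) i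
        (by simp only [Set.mem_ofPred_eq]; have := Finset.mem_range.1 hi; omega) le_rfl
  refine IndepFun.process_congr_left (X := fun (r : Set.Iic s) ω => B r ω - B ⊥ ω) key fun r => ?_
  filter_upwards [h0] with ω hω
  simp [hω]

/-- Every event of the augmented σ-algebra agrees up to a null set with one of the raw σ-algebra,
and the product formula sees only classes modulo null sets. -/
theorem IsStandardBrownian.indep_augmentedFiltration [P.IsComplete] {T : ℝ} [Fact (0 ≤ T)]
    {κ : Type*} [Fintype κ] {B : Set.Icc (0 : ℝ) T → Ω → κ → ℝ} (hB : IsStandardBrownian B P)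
    {s t : Set.Icc (0 : ℝ) T} (hst : s ≤ t) :
    Indep (augmentedFiltration B hB.measurable P s)
      (MeasurableSpace.comap (fun ω => B t ω - B s ω) inferInstance) P := by
  have hpath := HasIndepIncrements.indepFun_path hB.measurable hB.indep_increments hB.zero hst
  have hraw : Indep (rawFiltration B hB.measurable s)
      (MeasurableSpace.comap (fun ω => B t ω - B s ω) inferInstance) P := by
    refine indep_of_indep_of_le_left hpath (iSup₂_le fun r hr => ?_)
    rw [← measurable_iff_comap_le]
    have hr' : Measurable fun f : Set.Iic s → κ → ℝ => f ⟨r, hr⟩ := measurable_pi_apply _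
    exact hr'.comp (comap_measurable _)
  have hle : augmentedFiltration B hB.measurable P s
      ≤ eventuallyMeasurableSpace (rawFiltration B hB.measurable s) (ae P) := by
    refine sup_le (fun A hA => ⟨A, hA, EventuallyEq.refl _ _⟩)
      (MeasurableSpace.generateFrom_le fun N hN => ?_)
    exact ⟨∅, @MeasurableSet.empty _ (_), ae_eq_empty.2 hN⟩
  rw [Indep_iff] at hraw ⊢
  intro A C hA hC
  obtain ⟨A', hA', hAA'⟩ := hle A hA
  rw [measure_congr (hAA'.inter (ae_eq_refl C)), measure_congr hAA']
  exact hraw A' C hA' hC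

end Independence

/-! ### Exponential moments of Gaussian increments. -/

section Exponential

variable {Ω : Type*} [mΩ : MeasurableSpace Ω] {P : Measure Ω}

theorem lintegral_exp_pi_gaussianReal {κ : Type*} [Fintype κ] (v : NNReal) (x : κ → ℝ) :
    ∫⁻ y, ENNReal.ofReal (Real.exp (-(∑ i, x i * y i)))
      ∂(Measure.pi fun _ : κ => gaussianReal 0 v)
      = ENNReal.ofReal (Real.exp (v / 2 * ∑ i, x i ^ 2)) := by
  have hprod : ∀ y : κ → ℝ, Real.exp (-(∑ i, x i * y i)) = ∏ i, Real.exp (-x i * y i) := by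
    intro y
    rw [← Real.exp_sum, ← Finset.sum_neg_distrib]
    simp
  have hint : Integrable (fun y : κ → ℝ => ∏ i, Real.exp (-x i * y i))
      (Measure.pi fun _ : κ => gaussianReal 0 v) :=
    Integrable.fintype_prod (f := fun i y => Real.exp (-x i * y))
      fun i => integrable_exp_mul_gaussianReal (-x i)
  simp_rw [hprod]
  rw [← ofReal_integral_eq_lintegral_ofReal hint
    (Eventually.of_forall fun y => Finset.prod_nonneg fun i _ => (Real.exp_pos _).le),
    integral_fintype_prod_eq_prod (fun i y => Real.exp (-x i * y)), Finset.mul_sum, Real.exp_sum]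
  congr 1
  refine Finset.prod_congr rfl fun i _ => ?_
  have := congrFun (mgf_id_gaussianReal (μ := 0) (v := v)) (-x i)
  simp only [mgf, id] at this
  rw [this]
  congr 1
  ring

variable [IsProbabilityMeasure P] [P.IsComplete] {T : ℝ} [Fact (0 ≤ T)] {κ : Type*} [Fintype κ]

/-- One step of the exponential martingale. By independence the past (`G`, `x`) can be frozen while
the increment is integrated out, and the quadratic correction cancels the Gaussian Laplace transform
exactly. -/
theorem IsStandardBrownian.lintegral_mul_exp_increment
    {B : Set.Icc (0 : ℝ) T → Ω → κ → ℝ} (hB : IsStandardBrownian B P)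
    {s t : Set.Icc (0 : ℝ) T} (hst : s ≤ t) {G : Ω → ENNReal} {x : Ω → κ → ℝ}
    (hG : Measurable[augmentedFiltration B hB.measurable P s] G)
    (hx : Measurable[augmentedFiltration B hB.measurable P s] x) :
    ∫⁻ ω, G ω * ENNReal.ofReal (Real.exp (-(∑ i, x ω i * (B t ω i - B s ω i))
      - ((t : ℝ) - s) / 2 * ∑ i, x ω i ^ 2)) ∂P = ∫⁻ ω, G ω ∂P := by
  set 𝓖 := augmentedFiltration B hB.measurable P with h𝓖
  have hpair : Measurable[𝓖 s] fun ω => (G ω, x ω) := hG.prodMk hx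
  have hpair' : Measurable fun ω => (G ω, x ω) := hpair.mono (𝓖.le s) le_rfl
  have hΔ : Measurable fun ω => B t ω - B s ω := (hB.measurable t).sub (hB.measurable s)
  have hind : IndepFun (fun ω => (G ω, x ω)) (fun ω => B t ω - B s ω) P :=
    indep_of_indep_of_le_left (hB.indep_augmentedFiltration hst)
      (measurable_iff_comap_le.1 hpair)
  have hmap := (indepFun_iff_map_prod_eq_prod_map_map hpair'.aemeasurable hΔ.aemeasurable).1 hind
  have hlaw : Measure.map (fun ω => B t ω - B s ω) P
      = Measure.pi fun _ : κ => gaussianReal 0 (Real.toNNReal (t - s)) :=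
    (hB.law_increments s t hst).map_eq
  let F : (ENNReal × (κ → ℝ)) × (κ → ℝ) → ENNReal := fun z =>
    z.1.1 * ENNReal.ofReal (Real.exp (-(∑ i, z.1.2 i * z.2 i)
      - ((t : ℝ) - s) / 2 * ∑ i, z.1.2 i ^ 2))
  have hF : Measurable F := by fun_prop
  have h1 : ∫⁻ ω, G ω * ENNReal.ofReal (Real.exp (-(∑ i, x ω i * (B t ω i - B s ω i))
      - ((t : ℝ) - s) / 2 * ∑ i, x ω i ^ 2)) ∂P
      = ∫⁻ z, F z ∂(Measure.map (fun ω => ((G ω, x ω), B t ω - B s ω)) P) := by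
    rw [lintegral_map hF (hpair'.prodMk hΔ)]
    rfl
  have hinner : ∀ a : ENNReal × (κ → ℝ), ∫⁻ y, F (a, y)
      ∂(Measure.pi fun _ : κ => gaussianReal 0 (Real.toNNReal (t - s))) = a.1 := by
    intro a
    have h2 : ∀ y, F (a, y) = (a.1 * ENNReal.ofReal (Real.exp
        (-(((t : ℝ) - s) / 2 * ∑ i, a.2 i ^ 2))))
          * ENNReal.ofReal (Real.exp (-(∑ i, a.2 i * y i))) := by
      intro y
      rw [mul_assoc, ← ENNReal.ofReal_mul (Real.exp_pos _).le, ← Real.exp_add]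
      simp only [F]
      congr 3
      ring
    simp_rw [h2]
    rw [lintegral_const_mul _ (by fun_prop), lintegral_exp_pi_gaussianReal, mul_assoc,
      ← ENNReal.ofReal_mul (Real.exp_pos _).le, ← Real.exp_add,
      Real.coe_toNNReal _ (sub_nonneg.2 (by exact_mod_cast hst))]
    simp
  rw [h1, hmap, hlaw, lintegral_prod _ hF.aemeasurable]
  simp_rw [hinner]
  rw [lintegral_map measurable_fst hpair']

end Exponential

/-! ### The time measure and simple integrands. -/

instance isFiniteMeasure_timeMeasure (T : ℝ) : IsFiniteMeasure (timeMeasure T) := by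
  refine ⟨?_⟩
  rw [timeMeasure, (MeasurableEmbedding.subtype_coe measurableSet_Icc).comap_apply,
    Set.image_univ, Subtype.range_coe, Real.volume_Icc]
  exact ENNReal.ofReal_lt_top

theorem timeMeasure_Ioc {T : ℝ} (a b : Set.Icc (0 : ℝ) T) :
    timeMeasure T (Set.Ioc a b) = ENNReal.ofReal (b - a) := by
  rw [timeMeasure, (MeasurableEmbedding.subtype_coe measurableSet_Icc).comap_apply]
  have : (Subtype.val '' Set.Ioc a b : Set ℝ) = Set.Ioc (a : ℝ) b := by
    ext x
    constructor
    · rintro ⟨y, hy, rfl⟩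
      exact hy
    · intro hx
      exact ⟨⟨x, a.2.1.trans hx.1.le, hx.2.trans b.2.2⟩, hx, rfl⟩
  rw [this, Real.volume_Ioc]

section

variable {Ω : Type*} [mΩ : MeasurableSpace Ω] {T : ℝ} {κ : Type*}

theorem measurable_augmentedFiltration {P : Measure Ω} [P.IsComplete]
    {B : Set.Icc (0 : ℝ) T → Ω → κ → ℝ} (hB : ∀ t, Measurable (B t)) (t : Set.Icc (0 : ℝ) T) :
    Measurable[augmentedFiltration B hB P t] (B t) := by
  rw [measurable_iff_comap_le]
  exact le_trans (le_iSup₂_of_le (f := fun s (_ : s ≤ t) =>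
    MeasurableSpace.comap (B s) inferInstance) t le_rfl le_rfl) le_sup_left

/-- The generators of the predictable σ-algebra are measurable rectangles, so it is contained in the
product σ-algebra. -/
theorem measurable_uncurry_of_isStronglyPredictable [Fact (0 ≤ T)] [Fintype κ]
    {𝓕 : Filtration (Set.Icc (0 : ℝ) T) mΩ}
    {u : Set.Icc (0 : ℝ) T → Ω → κ → ℝ} (hu : IsStronglyPredictable 𝓕 u) :
    Measurable (Function.uncurry u) := by
  refine Measurable.mono (StronglyMeasurable.measurable hu) ?_ le_rfl
  refine MeasurableSpace.generateFrom_le ?_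
  rintro A (⟨C, hC, rfl⟩ | ⟨i, C, hC, rfl⟩)
  · exact (measurableSet_singleton _).prod (𝓕.le _ _ hC)
  · exact measurableSet_Ioi.prod (𝓕.le _ _ hC)

namespace SimpleIntegrand

variable {𝓕 : Filtration (Set.Icc (0 : ℝ) T) mΩ}

theorem measurable_coeff_apply (φ : SimpleIntegrand 𝓕 κ) (k : Fin φ.N) (i : κ) :
    Measurable fun ω => φ.coeff k ω i :=
  (measurable_pi_apply i).comp ((φ.measurable_coeff k).mono (𝓕.le _) le_rfl)

theorem disjoint_Ioc (φ : SimpleIntegrand 𝓕 κ) {j k : Fin φ.N} (hjk : j ≠ k) :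
    Disjoint (Set.Ioc (φ.time j.castSucc) (φ.time j.succ))
      (Set.Ioc (φ.time k.castSucc) (φ.time k.succ)) := by
  rcases lt_or_gt_of_ne hjk with h | h
  · refine Set.disjoint_left.2 fun x hx hx' => ?_
    exact absurd (hx.2.trans (φ.monotone_time (Fin.le_def.2 (by simpa using h)))) (not_le.2 hx'.1)
  · refine Set.disjoint_left.2 fun x hx hx' => ?_
    exact absurd (hx'.2.trans (φ.monotone_time (Fin.le_def.2 (by simpa using h)))) (not_le.2 hx.1)

theorem measurable_process (φ : SimpleIntegrand 𝓕 κ) (i : κ) :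
    Measurable fun z : Set.Icc (0 : ℝ) T × Ω => φ.process z.1 z.2 i := by
  classical
  unfold process
  refine Finset.measurable_fun_sum _ fun k _ => ?_
  simp only [Set.indicator_apply]
  refine Measurable.ite (measurable_fst measurableSet_Ioc) ?_ measurable_const
  exact (φ.measurable_coeff_apply k i).comp measurable_snd

theorem process_eq_coeff (φ : SimpleIntegrand 𝓕 κ) {k : Fin φ.N} {s : Set.Icc (0 : ℝ) T}
    (hs : s ∈ Set.Ioc (φ.time k.castSucc) (φ.time k.succ)) (ω : Ω) (i : κ) :
    φ.process s ω i = φ.coeff k ω i := by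
  unfold process
  rw [Finset.sum_eq_single k]
  · simp [Set.indicator_of_mem hs]
  · intro j _ hjk
    exact Set.indicator_of_notMem (fun h => Set.disjoint_left.1 (φ.disjoint_Ioc hjk) h hs) _
  · simp

variable [Fintype κ]

/-- The energy `∫_0^T |φ_s|² ds` of a simple integrand. -/
noncomputable def energy (φ : SimpleIntegrand 𝓕 κ) (ω : Ω) : ℝ :=
  ∑ k, ((φ.time k.succ : ℝ) - φ.time k.castSucc) * ∑ i, φ.coeff k ω i ^ 2

theorem measurable_integral (φ : SimpleIntegrand 𝓕 κ) {B : Set.Icc (0 : ℝ) T → Ω → κ → ℝ}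
    (hB : ∀ t, Measurable (B t)) : Measurable (φ.integral B) := by
  unfold integral
  refine Finset.measurable_fun_sum _ fun k _ => Finset.measurable_fun_sum _ fun i _ => ?_
  exact (φ.measurable_coeff_apply k i).mul
    (((measurable_pi_apply i).comp (hB _)).sub ((measurable_pi_apply i).comp (hB _)))

theorem measurable_energy (φ : SimpleIntegrand 𝓕 κ) : Measurable φ.energy := by
  unfold energy
  refine Finset.measurable_fun_sum _ fun k _ => Measurable.const_mul ?_ _
  exact Finset.measurable_fun_sum _ fun i _ => (φ.measurable_coeff_apply k i).pow_const 2

/-- On each of the disjoint intervals the process equals its coefficient, so the energy is the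
integral over their union. Only this inequality is needed to bound the energy. -/
theorem ofReal_energy_le (φ : SimpleIntegrand 𝓕 κ) (ω : Ω) :
    ENNReal.ofReal (φ.energy ω)
      ≤ ∫⁻ s, ENNReal.ofReal (∑ i, φ.process s ω i ^ 2) ∂(timeMeasure T) := by
  have hΔ : ∀ k : Fin φ.N, 0 ≤ (φ.time k.succ : ℝ) - φ.time k.castSucc := fun k =>
    sub_nonneg.2 (φ.monotone_time (Fin.castSucc_le_succ k))
  have hsq : ∀ k : Fin φ.N, 0 ≤ ∑ i, φ.coeff k ω i ^ 2 := fun k =>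
    Finset.sum_nonneg fun i _ => sq_nonneg _
  rw [energy, ENNReal.ofReal_sum_of_nonneg fun k _ => mul_nonneg (hΔ k) (hsq k)]
  have hk : ∀ k : Fin φ.N,
      ENNReal.ofReal (((φ.time k.succ : ℝ) - φ.time k.castSucc) * ∑ i, φ.coeff k ω i ^ 2)
      = ∫⁻ s in Set.Ioc (φ.time k.castSucc) (φ.time k.succ),
          ENNReal.ofReal (∑ i, φ.process s ω i ^ 2) ∂(timeMeasure T) := by
    intro k
    rw [setLIntegral_congr_fun measurableSet_Ioc
      (g := fun _ => ENNReal.ofReal (∑ i, φ.coeff k ω i ^ 2))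
      (fun s hs => by simp only [φ.process_eq_coeff hs]),
      setLIntegral_const, timeMeasure_Ioc, mul_comm, ENNReal.ofReal_mul (hsq k)]
  simp_rw [hk]
  rw [← lintegral_biUnion_finset (fun j _ k _ hjk => φ.disjoint_Ioc hjk)
    (fun _ _ => measurableSet_Ioc)]
  exact setLIntegral_le_lintegral _ _

end SimpleIntegrand

end

/-! ### The minimal martingale measure is finite and equivalent to `P`. -/

namespace Market

variable {Ω : Type*} [mΩ : MeasurableSpace Ω] {P : Measure Ω} {T : ℝ} [Fact (0 ≤ T)] {m n : ℕ}

theorem measurable_W (M : Market Ω P T m n) (t : Set.Icc (0 : ℝ) T) : Measurable (M.W t) :=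
  measurable_pi_lambda _ fun i =>
    (measurable_pi_apply (Sum.inl i)).comp (M.isBrownian.measurable t)

theorem measurable_lam (M : Market Ω P T m n) : Measurable (Function.uncurry M.lam) :=
  measurable_uncurry_of_isStronglyPredictable M.predictable_lam

variable [P.IsComplete]

/-- The stochastic exponential of a simple integrand has expectation one. -/
theorem lintegral_exp_simpleIntegrand (M : Market Ω P T m n) [IsProbabilityMeasure P]
    (φ : SimpleIntegrand M.𝓕 (Fin m)) :
    ∫⁻ ω, ENNReal.ofReal (Real.exp (-φ.integral M.W ω - φ.energy ω / 2)) ∂P = 1 := by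
  -- The coefficients are extended by zero to the coordinates of `W^⊥`, so that independence can be
  -- used for the whole Brownian motion and its filtration.
  let x : Fin φ.N → Ω → (Fin m ⊕ Fin n) → ℝ := fun k ω => Sum.elim (φ.coeff k ω) 0
  let d : Fin φ.N → Ω → ℝ := fun k ω =>
    -(∑ i, x k ω i * (M.Wbar (φ.time k.succ) ω i - M.Wbar (φ.time k.castSucc) ω i))
      - ((φ.time k.succ : ℝ) - φ.time k.castSucc) / 2 * ∑ i, x k ω i ^ 2
  have hx : ∀ k, Measurable[M.𝓕 (φ.time k.castSucc)] (x k) := by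
    intro k
    refine @measurable_pi_lambda _ _ _ (_) _ _ ?_
    rintro (i | i)
    · exact (measurable_pi_apply i).comp (φ.measurable_coeff k)
    · exact measurable_const
  have hd : ∀ k, Measurable[M.𝓕 (φ.time k.succ)] (d k) := by
    intro k
    have hle : φ.time k.castSucc ≤ φ.time k.succ := φ.monotone_time (Fin.castSucc_le_succ k)
    have h1 : Measurable[M.𝓕 (φ.time k.succ)] (x k) := (hx k).mono (M.𝓕.mono hle) le_rfl
    have h2 : Measurable[M.𝓕 (φ.time k.succ)] (M.Wbar (φ.time k.succ)) :=
      measurable_augmentedFiltration M.isBrownian.measurable _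
    have h3 : Measurable[M.𝓕 (φ.time k.succ)] (M.Wbar (φ.time k.castSucc)) :=
      (measurable_augmentedFiltration M.isBrownian.measurable _).mono (M.𝓕.mono hle) le_rfl
    let f : ((Fin m ⊕ Fin n) → ℝ) × ((Fin m ⊕ Fin n) → ℝ) × ((Fin m ⊕ Fin n) → ℝ) → ℝ := fun z =>
      -(∑ i, z.1 i * (z.2.1 i - z.2.2 i))
        - ((φ.time k.succ : ℝ) - φ.time k.castSucc) / 2 * ∑ i, z.1 i ^ 2
    have hf : Measurable f := by fun_prop
    exact hf.comp (h1.prodMk (h2.prodMk h3))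
  let e : ℕ → Ω → ℝ := fun k ω => if h : k < φ.N then d ⟨k, h⟩ ω else 0
  -- Induction over the partition: the product of the first `j` factors is measurable at the `j`-th
  -- time and plays the role of `G` for the next increment.
  have key : ∀ j (hj : j ≤ φ.N),
      Measurable[M.𝓕 (φ.time ⟨j, Nat.lt_succ_of_le hj⟩)] (fun ω => ∑ k ∈ Finset.range j, e k ω) ∧
      ∫⁻ ω, ENNReal.ofReal (Real.exp (∑ k ∈ Finset.range j, e k ω)) ∂P = 1 := by
    intro j
    induction j with
    | zero =>
      intro _
      refine ⟨?_, by simp⟩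
      simp only [Finset.range_zero, Finset.sum_empty]
      exact measurable_const
    | succ j ih =>
      intro hj
      obtain ⟨hm, hi⟩ := ih (by omega)
      have hej : e j = d ⟨j, hj⟩ := by
        funext ω
        simp [e, Nat.lt_of_succ_le hj]
      simp_rw [Finset.sum_range_succ]
      constructor
      · refine Measurable.add (hm.mono (M.𝓕.mono (φ.monotone_time ?_)) le_rfl) ?_
        · exact Fin.le_def.2 (by simp)
        · rw [hej]
          exact hd ⟨j, hj⟩
      · have hG : Measurable[M.𝓕 (φ.time (Fin.castSucc ⟨j, hj⟩))]
            fun ω => ENNReal.ofReal (Real.exp (∑ k ∈ Finset.range j, e k ω)) :=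
          ENNReal.measurable_ofReal.comp (Real.measurable_exp.comp hm)
        have := M.isBrownian.lintegral_mul_exp_increment
          (φ.monotone_time (Fin.castSucc_le_succ ⟨j, hj⟩)) hG (hx ⟨j, hj⟩)
        rw [hi] at this
        rw [← this]
        refine lintegral_congr fun ω => ?_
        rw [Real.exp_add, ENNReal.ofReal_mul (Real.exp_pos _).le, hej]
  rw [← (key φ.N le_rfl).2]
  refine lintegral_congr fun ω => ?_
  have hsum : ∑ k ∈ Finset.range φ.N, e k ω = ∑ k, d k ω := by
    rw [Finset.sum_range]
    refine Finset.sum_congr rfl fun k _ => ?_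
    simp [e]
  rw [hsum]
  congr 2
  simp only [d, x, SimpleIntegrand.integral, SimpleIntegrand.energy, Finset.sum_sub_distrib,
    Finset.sum_neg_distrib, Finset.sum_div, Fintype.sum_sum_type, Sum.elim_inl, Sum.elim_inr,
    Pi.zero_apply, zero_mul, Finset.sum_const_zero, add_zero, W]
  congr 1
  refine Finset.sum_congr rfl fun k _ => ?_
  simp
  ring

/-- The exponential `exp (-∫_0^T λ_s · dW_s)` has finite expectation. -/
theorem lintegral_exp_neg_lt_top (M : Market Ω P T m n) [IsProbabilityMeasure P] {I : Ω → ℝ}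
    (hI : IsItoIntegral M.𝓕 P M.W M.lam I) :
    ∫⁻ ω, ENNReal.ofReal (Real.exp (-I ω)) ∂P < ⊤ := by
  obtain ⟨hIm, φ, hφ, hφI⟩ := hI
  have hIm' : Measurable I := hIm.mono (M.𝓕.le _) le_rfl
  obtain ⟨C, hC⟩ := M.bounded_lam
  have hlam : ∀ i, Measurable fun z : Set.Icc (0 : ℝ) T × Ω => M.lam z.1 z.2 i := fun i =>
    (measurable_pi_apply i).comp M.measurable_lam
  let a : ℕ → Ω → ENNReal := fun j ω => ∫⁻ s,
      ENNReal.ofReal (∑ i, ((φ j).process s ω i - M.lam s ω i) ^ 2) ∂(timeMeasure T)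
  let b : ℕ → Ω → ENNReal := fun j ω => ENNReal.ofReal (((φ j).integral M.W ω - I ω) ^ 2)
  have ham : ∀ j, Measurable (a j) := by
    intro j
    refine Measurable.lintegral_prod_left' (f := fun z : Set.Icc (0 : ℝ) T × Ω =>
      ENNReal.ofReal (∑ i, ((φ j).process z.1 z.2 i - M.lam z.1 z.2 i) ^ 2)) ?_
    refine ENNReal.measurable_ofReal.comp (Finset.measurable_fun_sum _ fun i _ => ?_)
    exact (((φ j).measurable_process i).sub (hlam i)).pow_const 2
  have hbm : ∀ j, Measurable (b j) := fun j =>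
    ENNReal.measurable_ofReal.comp
      ((((φ j).measurable_integral M.measurable_W).sub hIm').pow_const 2)
  have hsum : Tendsto (fun j => ∫⁻ ω, a j ω + b j ω ∂P) atTop (𝓝 0) := by
    simp_rw [lintegral_add_left (ham _)]
    simpa using hφ.add hφI
  -- Geometric errors are summable, which gives almost sure convergence along a subsequence,
  -- simultaneously for integrands and integrals.
  have hsub : ∀ k : ℕ, ∃ j, ∫⁻ ω, a j ω + b j ω ∂P < (2⁻¹ : ENNReal) ^ k := fun k =>
    ((tendsto_order.1 hsum).2 _ (ENNReal.pow_pos (by simp) k)).exists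
  choose j hj using hsub
  have hae : ∀ᵐ ω ∂P, Tendsto (fun k => a (j k) ω + b (j k) ω) atTop (𝓝 0) := by
    have hadd : ∀ k, Measurable fun ω => a (j k) ω + b (j k) ω := fun k => (ham _).add (hbm _)
    have hfin : ∫⁻ ω, ∑' k, (a (j k) ω + b (j k) ω) ∂P ≠ ⊤ := by
      rw [lintegral_tsum fun k => (hadd k).aemeasurable]
      refine ne_top_of_le_ne_top ?_ (ENNReal.tsum_le_tsum fun k => (hj k).le)
      rw [ENNReal.tsum_geometric]
      simp
    filter_upwards [ae_lt_top (Measurable.tsum hadd) hfin]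
      with ω hω using ENNReal.tendsto_atTop_zero_of_tsum_ne_top hω.ne
  -- `L` is twice the energy bound for `λ`, coming from |p|² ≤ 2|p - λ|² + 2|λ|²; the extra 2 in `K`
  -- covers paths on which the approximation error is at most 1.
  let L : ENNReal := 2 * ENNReal.ofReal (∑ _ : Fin m, C ^ 2) * timeMeasure T Set.univ
  have hL : 2 + L ≠ ⊤ := by
    refine ENNReal.add_ne_top.2 ⟨by simp, ENNReal.mul_ne_top ?_ (measure_ne_top _ _)⟩
    exact ENNReal.mul_ne_top (by simp) ENNReal.ofReal_ne_top
  let K : ℝ := (2 + L).toReal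
  have henergy : ∀ j ω, a j ω ≤ 1 → (φ j).energy ω ≤ K := by
    intro j ω hj1
    rw [← ENNReal.ofReal_le_iff_le_toReal hL]
    refine ((φ j).ofReal_energy_le ω).trans ?_
    calc ∫⁻ s, ENNReal.ofReal (∑ i, (φ j).process s ω i ^ 2) ∂(timeMeasure T)
        ≤ ∫⁻ s, (2 * ENNReal.ofReal (∑ i, ((φ j).process s ω i - M.lam s ω i) ^ 2)
            + 2 * ENNReal.ofReal (∑ _ : Fin m, C ^ 2)) ∂(timeMeasure T) := by
          refine lintegral_mono fun s => ?_
          have h2 : (2 : ENNReal) = ENNReal.ofReal 2 := by simp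
          rw [h2, ← ENNReal.ofReal_mul zero_le_two, ← ENNReal.ofReal_mul zero_le_two,
            ← ENNReal.ofReal_add (by positivity) (by positivity)]
          refine ENNReal.ofReal_le_ofReal ?_
          rw [Finset.mul_sum, Finset.mul_sum, ← Finset.sum_add_distrib]
          refine Finset.sum_le_sum fun i _ => ?_
          have : M.lam s ω i ^ 2 ≤ C ^ 2 := sq_le_sq' (abs_le.1 (hC s ω i)).1 (abs_le.1 (hC s ω i)).2
          -- The difference of the two sides of p² ≤ 2(p - λ)² + 2λ² is the square (p - 2λ)².
          nlinarith [sq_nonneg ((φ j).process s ω i - 2 * M.lam s ω i)]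
      _ = 2 * a j ω + L := by
          rw [lintegral_add_right _ measurable_const, lintegral_const_mul' _ _ (by simp),
            lintegral_const]
      _ ≤ 2 + L := by
          gcongr
          simpa using mul_le_mul_right hj1 2
  let Z : ℕ → Ω → ENNReal := fun k ω =>
    ENNReal.ofReal (Real.exp (-(φ (j k)).integral M.W ω - (φ (j k)).energy ω / 2))
  have hZm : ∀ k, Measurable (Z k) := fun k =>
    ENNReal.measurable_ofReal.comp (Real.measurable_exp.comp
      (((φ (j k)).measurable_integral M.measurable_W).neg.sub
        ((φ (j k)).measurable_energy.div_const 2)))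
  -- Eventually the energy is at most `K`, so it can be replaced by this constant. Hence convergence
  -- of the energies is not needed, at the price of a factor exp(`K`/2) in the final bound.
  have hle : ∀ᵐ ω ∂P, ENNReal.ofReal (Real.exp (-(K / 2))) * ENNReal.ofReal (Real.exp (-I ω))
      ≤ liminf (fun k => Z k ω) atTop := by
    filter_upwards [hae] with ω hω
    have ha : ∀ᶠ k in atTop, a (j k) ω ≤ 1 := by
      filter_upwards [(tendsto_order.1 hω).2 1 one_pos] with k hk
      exact le_self_add.trans hk.le
    have hb : Tendsto (fun k => b (j k) ω) atTop (𝓝 0) :=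
      tendsto_of_tendsto_of_tendsto_of_le_of_le tendsto_const_nhds hω (fun _ => bot_le)
        fun _ => le_add_self
    have hb2 : Tendsto (fun k => ((φ (j k)).integral M.W ω - I ω) ^ 2) atTop (𝓝 0) := by
      have := (ENNReal.tendsto_toReal ENNReal.zero_ne_top).comp hb
      refine this.congr fun k => ?_
      exact ENNReal.toReal_ofReal (sq_nonneg _)
    have hIlim : Tendsto (fun k => (φ (j k)).integral M.W ω) atTop (𝓝 (I ω)) := by
      rw [tendsto_iff_dist_tendsto_zero]
      have := (Real.continuous_sqrt.tendsto 0).comp hb2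
      rw [Real.sqrt_zero] at this
      refine this.congr fun k => ?_
      simp [Real.sqrt_sq_eq_abs, Real.dist_eq]
    have hlim : Tendsto (fun k => ENNReal.ofReal
        (Real.exp (-(φ (j k)).integral M.W ω - K / 2))) atTop
        (𝓝 (ENNReal.ofReal (Real.exp (-I ω - K / 2)))) :=
      (ENNReal.continuous_ofReal.tendsto _).comp
        ((Real.continuous_exp.tendsto _).comp (hIlim.neg.sub_const _))
    rw [← ENNReal.ofReal_mul (Real.exp_pos _).le, ← Real.exp_add,
      show -(K / 2) + -I ω = -I ω - K / 2 by ring, ← hlim.liminf_eq]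
    refine liminf_le_liminf ?_
    filter_upwards [ha] with k hk
    refine ENNReal.ofReal_le_ofReal (Real.exp_le_exp.2 ?_)
    linarith [henergy _ _ hk]
  have hfatou : ENNReal.ofReal (Real.exp (-(K / 2))) * ∫⁻ ω, ENNReal.ofReal (Real.exp (-I ω)) ∂P
      ≤ 1 := by
    rw [← lintegral_const_mul' _ _ ENNReal.ofReal_ne_top]
    refine (lintegral_mono_ae hle).trans ((lintegral_liminf_le hZm).trans ?_)
    simp only [Z, M.lintegral_exp_simpleIntegrand]
    simp
  by_contra htop
  rw [not_lt, top_le_iff] at htop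
  rw [htop, ENNReal.mul_top (by simp [Real.exp_pos])] at hfatou
  simp at hfatou

variable {M : Market Ω P T m n} {Qmin : Measure Ω}

/-- The quadratic term only lowers the density, which is thus dominated by exp(-I). Finite mass
suffices for what follows; total mass one plays no role. -/
theorem IsMinimalMartingaleMeasure.isFiniteMeasure [IsProbabilityMeasure P]
    (h : M.IsMinimalMartingaleMeasure Qmin) : IsFiniteMeasure Qmin := by
  obtain ⟨I, hI, rfl⟩ := h
  refine isFiniteMeasure_withDensity (ne_top_of_le_ne_top (M.lintegral_exp_neg_lt_top hI).ne
    (lintegral_mono fun ω => ENNReal.ofReal_le_ofReal (Real.exp_le_exp.2 ?_)))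
  have : 0 ≤ ∫ s, ∑ i, M.lam s ω i ^ 2 ∂(timeMeasure T) :=
    integral_nonneg fun s => Finset.sum_nonneg fun i _ => sq_nonneg _
  linarith

theorem IsMinimalMartingaleMeasure.absolutelyContinuous
    (h : M.IsMinimalMartingaleMeasure Qmin) : Qmin ≪ P := by
  obtain ⟨I, hI, rfl⟩ := h
  exact withDensity_absolutelyContinuous _ _

theorem IsMinimalMartingaleMeasure.absolutelyContinuous'
    (h : M.IsMinimalMartingaleMeasure Qmin) : P ≪ Qmin := by
  obtain ⟨I, ⟨hIm, -⟩, rfl⟩ := h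
  have hIm' : Measurable I := hIm.mono (M.𝓕.le _) le_rfl
  have hlam : ∀ i, Measurable fun z : Set.Icc (0 : ℝ) T × Ω => M.lam z.1 z.2 i := fun i =>
    (measurable_pi_apply i).comp M.measurable_lam
  have hint : Measurable fun ω => ∫ s, ∑ i, M.lam s ω i ^ 2 ∂(timeMeasure T) := by
    refine (StronglyMeasurable.integral_prod_left
      (f := fun s ω => ∑ i, M.lam s ω i ^ 2) (Measurable.stronglyMeasurable ?_)).measurable
    exact Finset.measurable_fun_sum _ fun i _ => (hlam i).pow_const 2
  refine withDensity_absolutelyContinuous' (Measurable.aemeasurable ?_)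
    (Eventually.of_forall fun ω => by simp [Real.exp_pos])
  exact ENNReal.measurable_ofReal.comp (Real.measurable_exp.comp
    (hIm'.neg.sub (hint.const_mul _)))

end Market

/-! ### Conditional expectations of nonnegative and extended-real variables. -/

section ConditionalExpectation

variable {Ω : Type*} {m : MeasurableSpace Ω} [mΩ : MeasurableSpace Ω] {ν : Measure Ω}

/-- A measurable factor can be taken out of the conditional Lebesgue expectation. -/
theorem condLExp_mul_left (hm : m ≤ mΩ) [SigmaFinite (ν.trim hm)] {g X : Ω → ENNReal}
    (hg : Measurable[m] g) (hX : AEMeasurable X ν) :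
    condLExp m ν (fun ω => g ω * X ω) =ᵐ[ν] fun ω => g ω * condLExp m ν X ω := by
  -- `X` and its conditional expectation define the same measure on `m`, so they give the same
  -- integral against every `m`-measurable weight; no integrability is needed.
  have htrim : (ν.withDensity X).trim hm = (ν.withDensity (condLExp m ν X)).trim hm := by
    refine @Measure.ext _ m _ _ fun A hA => ?_
    rw [trim_measurableSet_eq hm hA, trim_measurableSet_eq hm hA, withDensity_apply _ (hm A hA),
      withDensity_apply _ (hm A hA), setLIntegral_condLExp hm ν X hA]
  have hmul : ∀ Y : Ω → ENNReal, AEMeasurable Y ν → ∀ A, MeasurableSet[m] A →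
      ∫⁻ ω in A, g ω * Y ω ∂ν = ∫⁻ ω, A.indicator g ω ∂((ν.withDensity Y).trim hm) := by
    intro Y hY A hA
    have hind : Measurable[m] (A.indicator g) := hg.indicator hA
    rw [lintegral_trim hm hind, lintegral_withDensity_eq_lintegral_mul₀ hY
      (hind.mono hm le_rfl).aemeasurable, ← lintegral_indicator (hm A hA)]
    refine lintegral_congr fun ω => ?_
    by_cases h : ω ∈ A <;> simp [h, mul_comm]
  refine (ae_eq_condLExp hm ν _ (hg.mul (measurable_condLExp m ν X)) fun A hA => ?_).symm
  rw [hmul _ hX A hA, htrim]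
  exact hmul _ (measurable_condLExp' m ν X).aemeasurable A hA

/-- Adding a constant to the second factor of `Y * ξ`, for `Y` nonnegative with finite conditional
expectation and `ξ` bounded. -/
theorem condExpE_mul_add_const {Y ξ : Ω → ℝ} (hY : AEMeasurable Y ν)
    (hξ : AEMeasurable ξ ν) (hY0 : ∀ᵐ ω ∂ν, 0 ≤ Y ω) {C : ℝ} (hC : ∀ᵐ ω ∂ν, |ξ ω| ≤ C)
    (hfin : ∀ᵐ ω ∂ν, condLExp m ν (fun ω' => ENNReal.ofReal (Y ω')) ω ≠ ⊤) (c : ℝ) :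
    ∀ᵐ ω ∂ν, condExpE m ν (fun ω' => Y ω' * (ξ ω' + c)) ω
      = condExpE m ν (fun ω' => Y ω' * ξ ω') ω
        + ((c * (condLExp m ν (fun ω' => ENNReal.ofReal (Y ω')) ω).toReal : ℝ) : EReal) := by
  set E : (Ω → ℝ) → Ω → ENNReal := fun V => condLExp m ν fun ω' => ENNReal.ofReal (V ω') with hE
  -- The positive and negative parts occurring below are all dominated by a multiple of `Y`. Their
  -- conditional expectations are thus finite, and no difference ∞ - ∞ arises.
  have bound : ∀ (V : Ω → ℝ) (K : ℝ), (∀ᵐ ω ∂ν, V ω ≤ K * Y ω) → ∀ᵐ ω ∂ν, E V ω ≠ ⊤ := by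
    intro V K hV
    have h1 : E V ≤ᵐ[ν] condLExp m ν (ENNReal.ofReal K • fun ω => ENNReal.ofReal (Y ω)) := by
      refine condLExp_mono ?_
      filter_upwards [hV, hY0] with ω h h0
      rw [Pi.smul_apply, smul_eq_mul, ← ENNReal.ofReal_mul' h0]
      exact ENNReal.ofReal_le_ofReal h
    filter_upwards [h1, hfin, condLExp_smul' (mΩ := m) (P := ν) (fun ω => ENNReal.ofReal (Y ω))
      (ENNReal.ofReal_ne_top (r := K))] with ω h1 h2 h3
    rw [h3] at h1
    exact ne_top_of_le_ne_top (ENNReal.mul_ne_top ENNReal.ofReal_ne_top h2) h1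
  let X : Ω → ℝ := fun ω => Y ω * ξ ω
  let X' : Ω → ℝ := fun ω => Y ω * (ξ ω + c)
  have hX : AEMeasurable X ν := hY.mul hξ
  have hX' : AEMeasurable X' ν := hY.mul (hξ.add_const c)
  have hp := bound X C (by
    filter_upwards [hY0, hC] with ω h0 h
    nlinarith [(abs_le.1 h).2])
  have hn := bound (fun ω => -X ω) C (by
    filter_upwards [hY0, hC] with ω h0 h
    nlinarith [(abs_le.1 h).1])
  have hp' := bound X' (C + c) (by
    filter_upwards [hY0, hC] with ω h0 h
    nlinarith [(abs_le.1 h).2])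
  have hn' := bound (fun ω => -X' ω) (C - c) (by
    filter_upwards [hY0, hC] with ω h0 h
    nlinarith [(abs_le.1 h).1])
  have hofReal : ∀ V : Ω → ℝ, AEMeasurable V ν → AEMeasurable (fun ω => ENNReal.ofReal (V ω)) ν :=
    fun V hV => ENNReal.measurable_ofReal.comp_aemeasurable hV
  have hadd : ∀ (V U : Ω → ℝ) (a : ℝ), AEMeasurable V ν → AEMeasurable U ν →
      condLExp m ν (((fun ω => ENNReal.ofReal (V ω)) + fun ω => ENNReal.ofReal (U ω))
        + ENNReal.ofReal a • fun ω => ENNReal.ofReal (Y ω))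
      =ᵐ[ν] fun ω => E V ω + E U ω + ENNReal.ofReal a * E Y ω := by
    intro V U a hV hU
    filter_upwards [condLExp_add_left (mΩ := m) (ENNReal.ofReal a • fun ω => ENNReal.ofReal (Y ω))
      ((hofReal V hV).add (hofReal U hU)),
      condLExp_add_left (mΩ := m) (fun ω => ENNReal.ofReal (U ω)) (hofReal V hV),
      condLExp_smul' (mΩ := m) (P := ν) (fun ω => ENNReal.ofReal (Y ω))
      (ENNReal.ofReal_ne_top (r := a))] with ω h1 h2 h3
    rw [h1, Pi.add_apply, h2, h3]
    rfl
  -- The identity `X' = X + c * Y`, with `X'`, `X` and `c` split into positive and negative parts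
  -- and rearranged to contain only sums of nonnegative terms.
  have heq : condLExp m ν (((fun ω => ENNReal.ofReal (X' ω)) + fun ω => ENNReal.ofReal (-X ω))
        + ENNReal.ofReal (-c) • fun ω => ENNReal.ofReal (Y ω))
      =ᵐ[ν] condLExp m ν (((fun ω => ENNReal.ofReal (-X' ω)) + fun ω => ENNReal.ofReal (X ω))
        + ENNReal.ofReal c • fun ω => ENNReal.ofReal (Y ω)) := by
    refine condLExp_congr_ae ?_
    filter_upwards [hY0] with ω h0
    simp only [Pi.add_apply, Pi.smul_apply, smul_eq_mul]
    have hpm : ∀ x : ℝ, (ENNReal.ofReal x).toReal - (ENNReal.ofReal (-x)).toReal = x := by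
      intro x
      rw [ENNReal.toReal_ofReal', ENNReal.toReal_ofReal']
      exact max_zero_sub_eq_self x
    rw [← ENNReal.toReal_eq_toReal_iff' (by finiteness) (by finiteness),
      ENNReal.toReal_add (by finiteness) (by finiteness),
      ENNReal.toReal_add (by finiteness) (by finiteness),
      ENNReal.toReal_add (by finiteness) (by finiteness),
      ENNReal.toReal_add (by finiteness) (by finiteness), ENNReal.toReal_mul, ENNReal.toReal_mul,
      ENNReal.toReal_ofReal h0]
    have hXX : X' ω = X ω + c * Y ω := by simp only [X, X']; ring
    linear_combination hpm (X' ω) - hpm (X ω) - Y ω * hpm c + hXX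
  filter_upwards [hp, hn, hp', hn', hfin, heq, hadd X' (fun ω => -X ω) (-c) hX' hX.neg,
    hadd (fun ω => -X' ω) X c hX'.neg hX] with ω hp hn hp' hn' hy h h1 h2
  rw [h1, h2] at h
  change E Y ω ≠ ⊤ at hy
  have hpmc : (ENNReal.ofReal c).toReal - (ENNReal.ofReal (-c)).toReal = c := by
    rw [ENNReal.toReal_ofReal', ENNReal.toReal_ofReal']
    exact max_zero_sub_eq_self c
  rw [← ENNReal.toReal_eq_toReal_iff' (by finiteness) (by finiteness),
    ENNReal.toReal_add (by finiteness) (by finiteness),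
    ENNReal.toReal_add (by finiteness) (by finiteness),
    ENNReal.toReal_add (by finiteness) (by finiteness),
    ENNReal.toReal_add (by finiteness) (by finiteness), ENNReal.toReal_mul, ENNReal.toReal_mul] at h
  change ((E X' ω : ENNReal) : EReal) - ((E (fun ω => -X' ω) ω : ENNReal) : EReal)
    = ((E X ω : ENNReal) : EReal) - ((E (fun ω => -X ω) ω : ENNReal) : EReal)
      + ((c * (E Y ω).toReal : ℝ) : EReal)
  have hcoe : ∀ p : ENNReal, p ≠ ⊤ → (p : EReal) = ((p.toReal : ℝ) : EReal) := by
    intro p hp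
    lift p to NNReal using hp
    rfl
  rw [hcoe _ hp, hcoe _ hn, hcoe _ hp', hcoe _ hn', ← EReal.coe_sub, ← EReal.coe_sub,
    ← EReal.coe_add]
  congr 1
  linear_combination h + (E Y ω).toReal * hpmc

variable [IsFiniteMeasure ν] {Q : Measure Ω} [IsFiniteMeasure Q]

/-- The density process of an equivalent measure is positive. -/
theorem condExp_toReal_rnDeriv_pos (hm : m ≤ mΩ) (hQν : Q ≪ ν) (hνQ : ν ≪ Q) :
    ∀ᵐ ω ∂ν, 0 < condExp m ν (fun ω => (Q.rnDeriv ν ω).toReal) ω := by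
  set D := condExp m ν (fun ω => (Q.rnDeriv ν ω).toReal) with hD
  have hDm : Measurable[m] D := stronglyMeasurable_condExp.measurable
  have hA : MeasurableSet[m] {ω | D ω ≤ 0} := hDm measurableSet_Iic
  -- The `Q`-mass of this event is the integral over it of `D`, which is nonpositive there.
  have hle : Q.real {ω | D ω ≤ 0} ≤ 0 := by
    rw [← Measure.setIntegral_toReal_rnDeriv hQν,
      ← setIntegral_condExp hm Measure.integrable_toReal_rnDeriv hA]
    exact setIntegral_nonpos (hm _ hA) fun ω h => h
  have h0 : ν {ω | D ω ≤ 0} = 0 := hνQ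
    ((measureReal_eq_zero_iff (measure_ne_top _ _)).1 (le_antisymm hle measureReal_nonneg))
  filter_upwards [measure_eq_zero_iff_ae_notMem.1 h0] with ω hω
  exact not_le.1 hω

end ConditionalExpectation

/-! ### Deterministic estimates for the `q`-functions. -/

/-- On its domain the base `b` of the `q`-exponential is nonnegative, so it is recovered as the
power `1 - q` of the value. Bounds on the value thus bound `b`, which is affine in `x`. Both `m₁`
and `m₂` enter because that power is increasing or decreasing according to the sign of `1 - q`. -/
theorem abs_le_of_expq_le {q γ m₁ m₂ x : ℝ} (hγ : 0 < γ) (hq1 : q ≠ 1) (hm₁ : 0 < m₁)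
    (hdom : -γ * x ∈ expqDomain q) (h₁ : m₁ ≤ expq q (-γ * x)) (h₂ : expq q (-γ * x) ≤ m₂) :
    |x| ≤ (1 + max (m₁ ^ (1 - q)) (m₂ ^ (1 - q))) / (|1 - q| * γ) := by
  have hq' : 1 - q ≠ 0 := sub_ne_zero.2 hq1.symm
  set b := 1 + (1 - q) * (-γ * x) with hb
  have hb0 : 0 ≤ b := by
    rcases hdom with ⟨-, h, hx⟩ | ⟨h, hx⟩
    · have h1 : 0 < 1 - q := by linarith
      have := mul_le_mul_of_nonneg_left hx h1.le
      rw [mul_neg, mul_one_div_cancel hq'] at this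
      linarith
    · have h1 : 1 - q < 0 := by linarith
      have := mul_lt_mul_of_neg_left hx h1
      rw [mul_neg, mul_one_div_cancel hq'] at this
      linarith
  have hbpow : b = expq q (-γ * x) ^ (1 - q) := by
    rw [expq, ← hb, ← Real.rpow_mul hb0, one_div_mul_cancel hq', Real.rpow_one]
  have hbM : b ≤ max (m₁ ^ (1 - q)) (m₂ ^ (1 - q)) := by
    rw [hbpow]
    rcases le_total 0 (1 - q) with h | h
    · exact le_max_of_le_right (Real.rpow_le_rpow (hm₁.le.trans h₁) h₂ h)
    · exact le_max_of_le_left (Real.rpow_le_rpow_of_nonpos hm₁ h₁ h)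
  have hpos : 0 < |1 - q| * γ := mul_pos (abs_pos.2 hq') hγ
  rw [le_div_iff₀ hpos]
  have : |x| * (|1 - q| * γ) = |1 - b| := by
    rw [show 1 - b = x * ((1 - q) * γ) by rw [hb]; ring, abs_mul, abs_mul, abs_of_pos hγ]
  rw [this]
  refine (abs_sub _ _).trans ?_
  rw [abs_one, abs_of_nonneg hb0]
  linarith

/-- Tangent line at 1 (Bernoulli's inequality). Taking conditional expectations of it replaces
conditional Jensen. -/
theorem rpow_le_add_mul {q z : ℝ} (hq : 0 ≤ q) (hq1 : q ≤ 1) (hz : 0 ≤ z) :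
    z ^ q ≤ (1 - q) + q * z := by
  have := rpow_one_add_le_one_add_mul_self (s := z - 1) (by linarith) hq hq1
  rw [add_sub_cancel] at this
  linarith

theorem mul_le_rpow_add {q z : ℝ} (hq : 1 ≤ q) (hz : 0 ≤ z) : q * z ≤ z ^ q + (q - 1) := by
  have := one_add_mul_self_le_rpow_one_add (s := z - 1) (by linarith) hq
  rw [add_sub_cancel] at this
  linarith

theorem rpow_mul_lnq {q x : ℝ} (hx : 0 < x) : x ^ q * lnq q x = (x - x ^ q) / (1 - q) := by
  rw [lnq, mul_div_assoc', mul_sub, ← Real.rpow_add hx]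
  simp

/-! ### Bounded claims and conditional moments of the density ratio. -/

namespace Market

variable {Ω : Type*} [mΩ : MeasurableSpace Ω] {P : Measure Ω} {T : ℝ} [Fact (0 ≤ T)] {m n : ℕ}
  [P.IsComplete] {M : Market Ω P T m n}

theorem exists_abs_le_of_mem_boundedClaims {q γ : ℝ} (hγ : 0 < γ) (hq1 : q ≠ 1)
    {t : Set.Icc (0 : ℝ) T} {ξ : Ω → ℝ} (hξ : ξ ∈ M.boundedClaims q γ t) :
    ∃ C, ∀ᵐ ω ∂P, |ξ ω| ≤ C := by
  obtain ⟨⟨-, hdom, -⟩, m₁, m₂, hm₁, hb⟩ := hξ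
  refine ⟨(1 + max (m₁ ^ (1 - q)) (m₂ ^ (1 - q))) / (|1 - q| * γ), ?_⟩
  filter_upwards [hdom, hb] with ω h1 h2 using abs_le_of_expq_le hγ hq1 hm₁ h1 h2.1 h2.2

section DensityRatio

variable {ν Q : Measure Ω} {t : Set.Icc (0 : ℝ) T}

theorem measurable_density (t : Set.Icc (0 : ℝ) T) : Measurable[M.𝓕 t] (M.density Q ν t) :=
  stronglyMeasurable_condExp.measurable

theorem measurable_densityRatio : Measurable (M.densityRatio Q ν t) :=
  ((measurable_density ⊤).mono (M.𝓕.le _) le_rfl).div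
    ((measurable_density t).mono (M.𝓕.le _) le_rfl)

variable [IsFiniteMeasure ν]

theorem condLExp_density :
    condLExp (M.𝓕 t) ν (fun ω => ENNReal.ofReal (M.density Q ν ⊤ ω))
      =ᵐ[ν] fun ω => ENNReal.ofReal (M.density Q ν t ω) := by
  have h0 : 0 ≤ᵐ[ν] M.density Q ν ⊤ :=
    condExp_nonneg (Eventually.of_forall fun ω => ENNReal.toReal_nonneg)
  filter_upwards [condLExp_ofReal (M.𝓕 t) (integrable_condExp (m := M.𝓕 ⊤)) h0,
    condExp_condExp_of_le (μ := ν) (f := fun ω => (Q.rnDeriv ν ω).toReal)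
      (M.𝓕.mono (le_top : t ≤ ⊤)) (M.𝓕.le ⊤)] with ω h1 h2
  refine h1.trans ?_
  change ENNReal.ofReal (condExp (M.𝓕 t) ν (M.density Q ν ⊤) ω) = _
  rw [density, h2]
  rfl

variable [IsFiniteMeasure Q]

theorem density_pos (hQν : Q ≪ ν) (hνQ : ν ≪ Q) (t : Set.Icc (0 : ℝ) T) :
    ∀ᵐ ω ∂ν, 0 < M.density Q ν t ω :=
  condExp_toReal_rnDeriv_pos (M.𝓕.le t) hQν hνQ

/-- The martingale property of the density process, after the positive `𝓕_t`-measurable factor 1/D_t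
is pulled out. -/
theorem condLExp_densityRatio (hQν : Q ≪ ν) (hνQ : ν ≪ Q) :
    ∀ᵐ ω ∂ν, condLExp (M.𝓕 t) ν (fun ω => ENNReal.ofReal (M.densityRatio Q ν t ω)) ω = 1 := by
  have hg : Measurable[M.𝓕 t] fun ω => ENNReal.ofReal (M.density Q ν t ω)⁻¹ :=
    ENNReal.measurable_ofReal.comp (measurable_density t).inv
  have hX : Measurable fun ω => ENNReal.ofReal (M.density Q ν ⊤ ω) :=
    ENNReal.measurable_ofReal.comp ((measurable_density ⊤).mono (M.𝓕.le _) le_rfl)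
  have hcongr : (fun ω => ENNReal.ofReal (M.densityRatio Q ν t ω)) =ᵐ[ν] fun ω =>
      ENNReal.ofReal (M.density Q ν t ω)⁻¹ * ENNReal.ofReal (M.density Q ν ⊤ ω) := by
    filter_upwards [density_pos (M := M) hQν hνQ t] with ω h
    rw [← ENNReal.ofReal_mul (inv_pos.2 h).le, densityRatio, div_eq_inv_mul]
  filter_upwards [condLExp_congr_ae (mΩ := M.𝓕 t) hcongr,
    condLExp_mul_left (M.𝓕.le t) hg hX.aemeasurable, condLExp_density (M := M) (Q := Q) (t := t),
    density_pos (M := M) hQν hνQ t] with ω h1 h2 h3 h4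
  rw [h1, h2, h3, ← ENNReal.ofReal_mul (inv_pos.2 h4).le, inv_mul_cancel₀ h4.ne',
    ENNReal.ofReal_one]

theorem densityRatio_pos (hQν : Q ≪ ν) (hνQ : ν ≪ Q) (t : Set.Icc (0 : ℝ) T) :
    ∀ᵐ ω ∂ν, 0 < M.densityRatio Q ν t ω := by
  filter_upwards [density_pos (M := M) hQν hνQ t, density_pos (M := M) hQν hνQ ⊤] with ω h1 h2 using div_pos h2 h1

variable {q : ℝ}

theorem condLExp_densityRatio_rpow_le_one (hq : 0 ≤ q) (hq1 : q ≤ 1) (hQν : Q ≪ ν) (hνQ : ν ≪ Q) :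
    ∀ᵐ ω ∂ν, condLExp (M.𝓕 t) ν
      (fun ω => ENNReal.ofReal (M.densityRatio Q ν t ω ^ q)) ω ≤ 1 := by
  have hle : (fun ω => ENNReal.ofReal (M.densityRatio Q ν t ω ^ q)) ≤ᵐ[ν]
      (fun _ => ENNReal.ofReal (1 - q))
        + ENNReal.ofReal q • fun ω => ENNReal.ofReal (M.densityRatio Q ν t ω) := by
    filter_upwards [densityRatio_pos (M := M) hQν hνQ t] with ω h
    simp only [Pi.add_apply, Pi.smul_apply, smul_eq_mul]
    rw [← ENNReal.ofReal_mul hq, ← ENNReal.ofReal_add (by linarith) (by positivity)]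
    exact ENNReal.ofReal_le_ofReal (rpow_le_add_mul hq hq1 h.le)
  filter_upwards [condLExp_mono (mΩ := M.𝓕 t) hle,
    condLExp_add_left (mΩ := M.𝓕 t) (P := ν) (X := fun _ => ENNReal.ofReal (1 - q))
      (ENNReal.ofReal q • fun ω => ENNReal.ofReal (M.densityRatio Q ν t ω)) aemeasurable_const,
    condLExp_smul' (mΩ := M.𝓕 t) (P := ν) (fun ω => ENNReal.ofReal (M.densityRatio Q ν t ω))
      (ENNReal.ofReal_ne_top (r := q)),
    condLExp_densityRatio (M := M) (t := t) hQν hνQ] with ω h1 h2 h3 h4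
  refine h1.trans ?_
  rw [h2, Pi.add_apply, h3, Pi.smul_apply, h4, condLExp_const (M.𝓕.le t), smul_eq_mul, mul_one,
    ← ENNReal.ofReal_add (by linarith) hq]
  simp

/-- Since D^q = (q - 1) D^q ln_q D + D and D is integrable, finite entropy controls the `q`-th
moment. -/
theorem lintegral_density_rpow_ne_top (hq : 1 < q) (hQν : Q ≪ ν) (hνQ : ν ≪ Q)
    (hH : M.entropy q Q ν < ⊤) : ∫⁻ ω, ENNReal.ofReal (M.density Q ν ⊤ ω ^ q) ∂ν ≠ ⊤ := by
  rw [entropy, if_pos hQν] at hH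
  set D := M.density Q ν ⊤ with hD
  have hD0 : ∀ᵐ ω ∂ν, 0 < D ω := density_pos (M := M) hQν hνQ ⊤
  have hDint : ∫⁻ ω, ENNReal.ofReal (D ω) ∂ν ≠ ⊤ := integrable_condExp.lintegral_lt_top.ne
  have hDm : Measurable D := (measurable_density ⊤).mono (M.𝓕.le _) le_rfl
  -- The negative part is at most D/(q - 1), hence integrable. Entropy below `⊤` therefore forces
  -- the positive part to be integrable too.
  have hneg : ∫⁻ ω, ENNReal.ofReal (-(D ω ^ q * lnq q (D ω))) ∂ν ≠ ⊤ := by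
    refine ne_top_of_le_ne_top (ENNReal.mul_ne_top (ENNReal.ofReal_ne_top (r := (q - 1)⁻¹)) hDint) ?_
    rw [← lintegral_const_mul' _ _ ENNReal.ofReal_ne_top]
    refine lintegral_mono_ae ?_
    filter_upwards [hD0] with ω h
    rw [← ENNReal.ofReal_mul (inv_nonneg.2 (by linarith)), rpow_mul_lnq h]
    refine ENNReal.ofReal_le_ofReal ?_
    rw [← div_neg, neg_sub, div_eq_inv_mul]
    refine mul_le_mul_of_nonneg_left ?_ (inv_nonneg.2 (by linarith))
    linarith [Real.rpow_nonneg h.le q]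
  have hpos : ∫⁻ ω, ENNReal.ofReal (D ω ^ q * lnq q (D ω)) ∂ν ≠ ⊤ := by
    intro htop
    rw [expectationE, htop] at hH
    lift ∫⁻ ω, ENNReal.ofReal (-(D ω ^ q * lnq q (D ω))) ∂ν to NNReal using hneg with r
    exact hH.ne (EReal.top_sub_coe r)
  have hsum : ∫⁻ ω, (ENNReal.ofReal (q - 1) * ENNReal.ofReal (D ω ^ q * lnq q (D ω))
      + ENNReal.ofReal (D ω)) ∂ν ≠ ⊤ := by
    rw [lintegral_add_right _ hDm.ennreal_ofReal, lintegral_const_mul' _ _ ENNReal.ofReal_ne_top]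
    exact ENNReal.add_ne_top.2 ⟨ENNReal.mul_ne_top ENNReal.ofReal_ne_top hpos, hDint⟩
  refine ne_top_of_le_ne_top hsum (lintegral_mono_ae ?_)
  filter_upwards [hD0] with ω h
  rw [← ENNReal.ofReal_mul (by linarith)]
  refine le_trans (ENNReal.ofReal_le_ofReal ?_) ENNReal.ofReal_add_le
  rw [rpow_mul_lnq h]
  have hq' : 1 - q ≠ 0 := by linarith
  have heq : (q - 1) * ((D ω - D ω ^ q) / (1 - q)) = -(D ω - D ω ^ q) := by
    rw [mul_div_assoc', div_eq_iff hq']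
    ring
  linarith

/-- D_T^q is integrable and D_t^(-q) is an `𝓕_t`-measurable factor. The product itself need not be
integrable, but its conditional expectation is finite. -/
theorem condLExp_densityRatio_rpow_ne_top (hq : 1 < q) (hQν : Q ≪ ν) (hνQ : ν ≪ Q)
    (hH : M.entropy q Q ν < ⊤) : ∀ᵐ ω ∂ν, condLExp (M.𝓕 t) ν
      (fun ω => ENNReal.ofReal (M.densityRatio Q ν t ω ^ q)) ω ≠ ⊤ := by
  have hg : Measurable[M.𝓕 t] fun ω => ENNReal.ofReal ((M.density Q ν t ω ^ q)⁻¹) :=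
    ENNReal.measurable_ofReal.comp ((measurable_density t).pow_const q).inv
  have hX : Measurable fun ω => ENNReal.ofReal (M.density Q ν ⊤ ω ^ q) :=
    ENNReal.measurable_ofReal.comp
      (((measurable_density ⊤).mono (M.𝓕.le _) le_rfl).pow_const q)
  have hcongr : (fun ω => ENNReal.ofReal (M.densityRatio Q ν t ω ^ q)) =ᵐ[ν] fun ω =>
      ENNReal.ofReal ((M.density Q ν t ω ^ q)⁻¹) * ENNReal.ofReal (M.density Q ν ⊤ ω ^ q) := by
    filter_upwards [density_pos (M := M) hQν hνQ t, density_pos (M := M) hQν hνQ ⊤] with ω h h'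
    rw [← ENNReal.ofReal_mul (by positivity), densityRatio, Real.div_rpow h'.le h.le,
      div_eq_inv_mul]
  filter_upwards [condLExp_congr_ae (mΩ := M.𝓕 t) hcongr,
    condLExp_mul_left (M.𝓕.le t) hg hX.aemeasurable,
    condLExp_ne_top (mΩ := M.𝓕 t) (lintegral_density_rpow_ne_top hq hQν hνQ hH)] with ω h1 h2 h3
  rw [h1, h2]
  exact ENNReal.mul_ne_top ENNReal.ofReal_ne_top h3

theorem one_le_condLExp_densityRatio_rpow (hq : 1 ≤ q) (hQν : Q ≪ ν) (hνQ : ν ≪ Q) :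
    ∀ᵐ ω ∂ν, 1 ≤ condLExp (M.𝓕 t) ν
      (fun ω => ENNReal.ofReal (M.densityRatio Q ν t ω ^ q)) ω := by
  have hle : ENNReal.ofReal q • (fun ω => ENNReal.ofReal (M.densityRatio Q ν t ω)) ≤ᵐ[ν]
      (fun _ => ENNReal.ofReal (q - 1)) + fun ω => ENNReal.ofReal (M.densityRatio Q ν t ω ^ q) := by
    filter_upwards [densityRatio_pos (M := M) hQν hνQ t] with ω h
    simp only [Pi.add_apply, Pi.smul_apply, smul_eq_mul]
    rw [← ENNReal.ofReal_mul (by linarith), ← ENNReal.ofReal_add (by linarith) (by positivity),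
      add_comm (q - 1)]
    exact ENNReal.ofReal_le_ofReal (mul_le_rpow_add hq h.le)
  filter_upwards [condLExp_mono (mΩ := M.𝓕 t) hle,
    condLExp_add_left (mΩ := M.𝓕 t) (P := ν) (X := fun _ => ENNReal.ofReal (q - 1))
      (fun ω => ENNReal.ofReal (M.densityRatio Q ν t ω ^ q)) aemeasurable_const,
    condLExp_smul' (mΩ := M.𝓕 t) (P := ν) (fun ω => ENNReal.ofReal (M.densityRatio Q ν t ω))
      (ENNReal.ofReal_ne_top (r := q)),
    condLExp_densityRatio (M := M) (t := t) hQν hνQ] with ω h1 h2 h3 h4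
  rw [h2, Pi.add_apply, h3, Pi.smul_apply, h4, condLExp_const (M.𝓕.le t), smul_eq_mul, mul_one,
    show q = (q - 1) + 1 by ring, ENNReal.ofReal_add (by linarith) zero_le_one] at h1
  simp only [add_sub_cancel_right, ENNReal.ofReal_one] at h1
  simpa using (ENNReal.add_le_add_iff_left ENNReal.ofReal_ne_top).1 h1

end DensityRatio

/-! ### Adding cash to the evaluation and to the price. -/

section Evaluation

variable [IsProbabilityMeasure P] {Qmin : Measure Ω} {q γ c : ℝ} {ξ : Ω → ℝ}
  {t : Set.Icc (0 : ℝ) T} {Q : Measure Ω}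

/-- The effect on the evaluation of adding cash: the cash is multiplied by the conditional
expectation of `(D_{t,T})^q`, which is at most one for `q < 1` and at least one for `q > 1`. -/
theorem exists_evaluation_add_const (hQmin : M.IsMinimalMartingaleMeasure Qmin) (hγ : 0 < γ)
    (hq : 0 < q) (hq1 : q ≠ 1) (hξ : ξ ∈ M.boundedClaims q γ ⊤)
    (hQ : Q ∈ M.finiteEntropyMeasures q Qmin) (c : ℝ) :
    ∀ᵐ ω ∂P, ∃ y : ℝ, (q < 1 → y ≤ 1) ∧ (1 < q → 1 ≤ y) ∧
      M.evaluation q γ Qmin t (fun ω' => ξ ω' + c) Q ω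
        = M.evaluation q γ Qmin t ξ Q ω + ((c * y : ℝ) : EReal) := by
  have := hQmin.isFiniteMeasure
  obtain ⟨⟨_, hQP, hPQ, -⟩, hH⟩ := hQ
  have hQν : Q ≪ Qmin := hQP.trans hQmin.absolutelyContinuous'
  have hνQ : Qmin ≪ Q := hQmin.absolutelyContinuous.trans hPQ
  obtain ⟨C, hC⟩ := exists_abs_le_of_mem_boundedClaims hγ hq1 hξ
  have hξm : Measurable ξ := hξ.1.1.mono (M.𝓕.le _) le_rfl
  have hfin : ∀ᵐ ω ∂Qmin, condLExp (M.𝓕 t) Qmin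
      (fun ω => ENNReal.ofReal (M.densityRatio Q Qmin t ω ^ q)) ω ≠ ⊤ := by
    rcases lt_or_gt_of_ne hq1 with h | h
    · filter_upwards [condLExp_densityRatio_rpow_le_one (M := M) (t := t) hq.le h.le hQν hνQ]
        with ω hω using ne_top_of_le_ne_top ENNReal.one_ne_top hω
    · exact condLExp_densityRatio_rpow_ne_top h hQν hνQ hH
  have hle : ∀ᵐ ω ∂Qmin, q < 1 → condLExp (M.𝓕 t) Qmin
      (fun ω => ENNReal.ofReal (M.densityRatio Q Qmin t ω ^ q)) ω ≤ 1 := by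
    by_cases h : q < 1
    · filter_upwards [condLExp_densityRatio_rpow_le_one (M := M) (t := t) hq.le h.le hQν hνQ]
        with ω hω _ using hω
    · exact Eventually.of_forall fun ω h' => absurd h' h
  have hge : ∀ᵐ ω ∂Qmin, 1 < q → 1 ≤ condLExp (M.𝓕 t) Qmin
      (fun ω => ENNReal.ofReal (M.densityRatio Q Qmin t ω ^ q)) ω := by
    by_cases h : 1 < q
    · filter_upwards [one_le_condLExp_densityRatio_rpow (M := M) (t := t) h.le hQν hνQ]
        with ω hω _ using hω
    · exact Eventually.of_forall fun ω h' => absurd h' h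
  have hY0 : ∀ᵐ ω ∂Qmin, 0 ≤ M.densityRatio Q Qmin t ω ^ q := by
    filter_upwards [densityRatio_pos (M := M) hQν hνQ t] with ω h using Real.rpow_nonneg h.le q
  have hadd := condExpE_mul_add_const (m := M.𝓕 t) (measurable_densityRatio.pow_const q).aemeasurable
    hξm.aemeasurable hY0 (hQmin.absolutelyContinuous.ae_le hC) hfin c
  refine hQmin.absolutelyContinuous'.ae_le ?_
  filter_upwards [hfin, hle, hge, hadd] with ω h1 h2 h3 h4
  refine ⟨(condLExp (M.𝓕 t) Qmin
    (fun ω => ENNReal.ofReal (M.densityRatio Q Qmin t ω ^ q)) ω).toReal,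
    fun h => ?_, fun h => ?_, ?_⟩
  · exact ENNReal.toReal_le_of_le_ofReal zero_le_one (by simpa using h2 h)
  · exact (ENNReal.ofReal_le_iff_le_toReal h1).1 (by simpa using h3 h)
  · rw [evaluation, h4, evaluation, add_right_comm]

/-- The left side is an `𝓕_t`-measurable lower bound for all evaluations of `η`, and the price of
`η` is the greatest such bound. -/
theorem pricing_add_const_le {ξ η : Ω → ℝ}
    (h : ∀ Q ∈ M.finiteEntropyMeasures q Qmin, ∀ᵐ ω ∂P,
      M.evaluation q γ Qmin t ξ Q ω + (c : EReal) ≤ M.evaluation q γ Qmin t η Q ω) :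
    ∀ᵐ ω ∂P, M.pricing q γ Qmin t ξ ω + (c : EReal) ≤ M.pricing q γ Qmin t η ω := by
  have hξ := essInfFamily_spec (M.𝓕 t) (M.𝓕.le t) P
    {X | ∃ Q ∈ M.finiteEntropyMeasures q Qmin, X = M.evaluation q γ Qmin t ξ Q}
  have hη := essInfFamily_spec (M.𝓕 t) (M.𝓕.le t) P
    {X | ∃ Q ∈ M.finiteEntropyMeasures q Qmin, X = M.evaluation q γ Qmin t η Q}
  have hmono : Monotone fun x : EReal => x + (c : EReal) := fun x y hxy => by
    dsimp only
    gcongr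
  refine hη.greatest (fun ω => M.pricing q γ Qmin t ξ ω + (c : EReal))
    (hmono.measurable.comp hξ.measurable) ?_
  rintro X ⟨Q, hQ, rfl⟩
  filter_upwards [hξ.le _ ⟨Q, hQ, rfl⟩, h Q hQ] with ω h1 h2
  exact (hmono h1).trans h2

end Evaluation

end Market

end TsallisPricing

theorem proposition4p2 {Ω : Type*} [mΩ : MeasurableSpace Ω] (P : Measure Ω)
    [IsProbabilityMeasure P] [P.IsComplete] (T : ℝ) [Fact (0 ≤ T)] (m n : ℕ)
    (M : TsallisPricing.Market Ω P T m n)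
    (Qmin : Measure Ω) (hQmin : M.IsMinimalMartingaleMeasure Qmin)
    (q γ : ℝ) (hγ : 0 < γ) (hq : 0 < q) (hq1 : q ≠ 1)
    (t : Set.Icc (0 : ℝ) T) (c : ℝ) (ξ : Ω → ℝ)
    (hξ : ξ ∈ M.boundedClaims q γ ⊤)
    (hξc : (fun ω => ξ ω + c) ∈ M.boundedClaims q γ ⊤) :
    ((q < 1 ∧ c ≤ 0 ∨ 1 < q ∧ 0 ≤ c) →
      ∀ᵐ ω ∂P, M.pricing q γ Qmin t ξ ω + (c : EReal)
        ≤ M.pricing q γ Qmin t (fun ω' => ξ ω' + c) ω) ∧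
    ((q < 1 ∧ 0 ≤ c ∨ 1 < q ∧ c ≤ 0) →
      ∀ᵐ ω ∂P, M.pricing q γ Qmin t (fun ω' => ξ ω' + c) ω
        ≤ M.pricing q γ Qmin t ξ ω + (c : EReal)) := by
  refine ⟨fun hc => TsallisPricing.Market.pricing_add_const_le fun Q hQ => ?_, fun hc => ?_⟩
  · filter_upwards [TsallisPricing.Market.exists_evaluation_add_const (t := t) hQmin hγ hq hq1 hξ hQ c]
      with ω ⟨y, hy1, hy2, h⟩
    rw [h]
    refine add_le_add_right (EReal.coe_le_coe_iff.2 ?_) _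
    rcases hc with ⟨h', hc⟩ | ⟨h', hc⟩
    · nlinarith [hy1 h']
    · nlinarith [hy2 h']
  -- Subadditivity is the same comparison with the roles exchanged: start from `ξ + c`, add `-c`,
  -- and use `c * (y - 1) ≤ 0`; then move `c` back, which is legitimate because it is real.
  · have hneg := TsallisPricing.Market.pricing_add_const_le (M := M) (Qmin := Qmin) (q := q) (γ := γ) (t := t) (c := -c)
      (ξ := fun ω => ξ ω + c) (η := ξ) fun Q hQ => by
        filter_upwards [TsallisPricing.Market.exists_evaluation_add_const (t := t) hQmin hγ hq hq1 hξ hQ c]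
          with ω ⟨y, hy1, hy2, h⟩
        rw [h, add_assoc, ← EReal.coe_add]
        refine add_le_of_nonpos_right (EReal.coe_nonpos.2 ?_)
        rcases hc with ⟨h', hc⟩ | ⟨h', hc⟩
        · nlinarith [hy1 h']
        · nlinarith [hy2 h']
    filter_upwards [hneg] with ω h
    have := add_le_add_left h (c : EReal)
    rwa [add_assoc, ← EReal.coe_add, neg_add_cancel, EReal.coe_zero, add_zero] at this
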